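/- Let $c\neq 0$ be a complex number and put $g(x,y)=\frac{c}{x-y}$, $f(x,y)=\frac{x-y+c}{x-y}$, $h(x,y)=\frac{x-y+c}{c}$, $t(x,y)=\frac{c^2}{(x-y+c)(x-y)}$. Let $T_{ij}(z)$, $1\le i,j\le 3$, $z\in\mathbb{C}$, be linear operators on a complex vector space $V$ that satisfy the defining relation of the Yangian of $\mathfrak{gl}_3$, $R_{12}(x,y)T_1(x)T_2(y)=T_2(y)T_1(x)R_{12}(x,y)$, where $T(z)=\sum_{i,j} e_{ij}\otimes T_{ij}(z)$ and $R(x,y)$ is proportional to $(x-y)\mathbf I+c\,\mathbf P$, $\mathbf P$ being the permutation of $\mathbb{C}^3\otimes\mathbb{C}^3$. Let $|0\rangle\in V$ satisfy $T_{ij}(z)|0\rangle=0$ for $j<i$ and $T_{ii}(z)|0\rangle=\lambda_i(z)|0\rangle$, and write $\mathsf r_k(z)=\lambda_k(z)/\lambda_2(z)$, $k=1,3$. A function with a set of variables as argument denotes the product over the set, likewise for products of the commuting operators $T_{ij}(x)$ with the same $i,j$; $\bar u_j=\bar u\setminus\{u_j\}$ and $\bar v_i=\bar v\setminus\{v_i\}$.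 The Izergin--Korepin determinant of two sets of $k$ elements is $$\mathsf K_k(\bar x|\bar y)=\prod_{\ell<m}g(x_\ell,x_m)g(y_m,y_\ell)\cdot h(\bar x,\bar y)\,\det[t(x_i,y_j)].$$ For sets $\bar u$, $\bar v$ with $\#\bar u=a$, $\#\bar v=b$ the Bethe vector is $$\mathbb B^{a,b}(\bar u;\bar v)=\sum\frac{\mathsf K_k(\bar v_{\rm I}|\bar u_{\rm I})}{\lambda_2(\bar v_{\rm II})\lambda_2(\bar u)}\,\frac{f(\bar v_{\rm II},\bar v_{\rm I})f(\bar u_{\rm I},\bar u_{\rm II})}{f(\bar v,\bar u)}\;T_{13}(\bar u_{\rm I})T_{12}(\bar u_{\rm II})T_{23}(\bar v_{\rm II})|0\rangle,$$ the sum being over all partitions $\bar u\Rightarrow\{\bar u_{\rm I},\bar u_{\rm II}\}$, $\bar v\Rightarrow\{\bar v_{\rm I},\bar v_{\rm II}\}$ with $\#\bar u_{\rm I}=\#\bar v_{\rm I}=k$. The coefficient is a rational function of the parameters that is regular when some $v_j$ equals some $u_i$, and its value there is the one obtained after cancelling the pole of $\mathsf K_k$. Let $\bar u=\{u_1,\dots,u_a\}$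 and $\bar v=\{v_1,\dots,v_b\}$ ($a,b\ge 0$) consist of $a+b$ pairwise distinct complex numbers with $v_j-u_i+c\ne 0$, $\lambda_2(u_i)\neq0$ and $\lambda_2(v_j)\neq 0$ for all $i,j$. Let $t(w)=T_{11}(w)+T_{22}(w)+T_{33}(w)$ and $$\Lambda(w)=\lambda_1(w)f(\bar u,w)+\lambda_2(w)f(w,\bar u)f(\bar v,w)+\lambda_3(w)f(w,\bar v),$$ $$X_j=\mathsf r_1(u_j)\frac{f(\bar u_j,u_j)}{f(\bar v,u_j)}-f(u_j,\bar u_j),\qquad Y_i=\mathsf r_3(v_i)\frac{f(v_i,\bar v_i)}{f(v_i,\bar u)}-f(\bar v_i,v_i).$$ (1) For every $w\in\mathbb{C}\setminus(\bar u\cup\bar v)$ with $\lambda_2(w)\ne0$, $w-u_j+c\neq 0$ and $v_i-w+c\neq 0$ for all $i,j$, $$\begin{aligned}t(w)\,\mathbb B^{a,b}(\bar u;\bar v)={}&\Lambda(w)\,\mathbb B^{a,b}(\bar u;\bar v)+\lambda_2(w)f(\bar v,w)\sum_{j=1}^a g(w,u_j)\,X_j\,\mathbb B^{a,b}(\{\bar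 u_j,w\};\bar v)\\&+\lambda_2(w)f(w,\bar u)\sum_{i=1}^b g(v_i,w)\,Y_i\,\mathbb B^{a,b}(\bar u;\{\bar v_i,w\})\\&+\lambda_2(w)\sum_{i=1}^b\sum_{j=1}^a g(v_i,u_j)\Big\{g(w,v_i)f(\bar v_i,v_i)X_j+g(u_j,w)f(u_j,\bar u_j)Y_i\Big\}\,\mathbb B^{a,b}(\{\bar u_j,w\};\{\bar v_i,w\}).\end{aligned}$$ (2) If $\bar u$, $\bar v$ satisfy the Bethe equations $$\mathsf r_1(u_i)f(\bar u_i,u_i)=f(u_i,\bar u_i)f(\bar v,u_i),\qquad \mathsf r_3(v_j)f(v_j,\bar v_j)=f(v_j,\bar u)f(\bar v_j,v_j)$$ for all $i=1,\dots,a$ and $j=1,\dots,b$, then $t(w)\,\mathbb B^{a,b}(\bar u;\bar v)=\Lambda(w)\,\mathbb B^{a,b}(\bar u;\bar v)$ for every $w\in\mathbb{C}\setminus(\bar u\cup\bar v)$; that is, $\mathbb B^{a,b}(\bar u;\bar v)$, if nonzero, is an eigenvector of the transfer matrix with eigenvalue $\Lambda(w)$. -/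

import Mathlib

namespace GL3Bethe

open scoped Kronecker

/-! ### Rational functions

Products over sets of parameters are written out as products over index sets. -/

/-- `g(x,y) = c / (x - y)`. -/
noncomputable def g (c x y : ℂ) : ℂ := c / (x - y)

/-- `f(x,y) = 1 + g(x,y) = (x - y + c) / (x - y)`.  With Lean's conventions `(f c x x)⁻¹ = 0`, which
is the value at `x = y` of the rational function `1 / f(x,y) = (x - y) / (x - y + c)`. -/
noncomputable def f (c x y : ℂ) : ℂ := (x - y + c) / (x - y)

/-- `h(x,y) = f(x,y) / g(x,y) = (x - y + c) / c`. -/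
noncomputable def h (c x y : ℂ) : ℂ := (x - y + c) / c

/-- `t(x,y) = g(x,y) / h(x,y) = c² / ((x - y + c) (x - y))`. -/
noncomputable def t (c x y : ℂ) : ℂ := c ^ 2 / ((x - y + c) * (x - y))

/-- `f(x̄_S, ȳ_S')`, the product of `f(x_i, y_j)` over `i ∈ S`, `j ∈ S'`. -/
noncomputable def fProd (c : ℂ) {m n : ℕ} (x : Fin m → ℂ) (S : Finset (Fin m))
    (y : Fin n → ℂ) (S' : Finset (Fin n)) : ℂ :=
  ∏ i ∈ S, ∏ j ∈ S', f c (x i) (y j)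

/-- The Vandermonde-like prefactor `∏_{ℓ < m} g(x_ℓ, x_m) g(y_m, y_ℓ)`. -/
noncomputable def ikPrefactor (c : ℂ) {k : ℕ} (x y : Fin k → ℂ) : ℂ :=
  ∏ m : Fin k, ∏ l ∈ Finset.univ.filter (fun l : Fin k => l < m), g c (x l) (x m) * g c (y m) (y l)

/-- The Izergin--Korepin determinant
`K_k(x̄|ȳ) = ∏_{ℓ < m} g(x_ℓ, x_m) g(y_m, y_ℓ) · h(x̄,ȳ) · det [t(x_i, y_j)]`. -/
noncomputable def izerginKorepin (c : ℂ) {k : ℕ} (x y : Fin k → ℂ) : ℂ :=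
  ikPrefactor c x y * (∏ i, ∏ j, h c (x i) (y j)) *
    Matrix.det (Matrix.of fun i j => t c (x i) (y j))

/-- The rational function `K_k(x̄|ȳ) / f(x̄,ȳ)`, written so that it is also correct when some `x_i`
equals some `y_j`: there the pole of `K_k` cancels against the zero of `1 / f`.  It is obtained by
multiplying the `i`-th row of `[t(x_i, y_j)]` by `∏_l 1 / g(x_i, y_l)` and cancelling. -/
noncomputable def reducedIK (c : ℂ) {k : ℕ} (x y : Fin k → ℂ) : ℂ :=
  ikPrefactor c x y *
    Matrix.det (Matrix.of fun i j =>
      (h c (x i) (y j))⁻¹ * ∏ l ∈ Finset.univ.erase j, (x i - y l) / c)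

/-- Away from the coincidences `reducedIK` is literally `K_k(x̄|ȳ) / f(x̄,ȳ)`. -/
theorem reducedIK_eq (c : ℂ) (hc : c ≠ 0) {k : ℕ} (x y : Fin k → ℂ)
    (hne : ∀ i j, x i ≠ y j) (hsh : ∀ i j, x i - y j + c ≠ 0) :
    reducedIK c x y = izerginKorepin c x y / ∏ i, ∏ j, f c (x i) (y j) := by
  have hsub : ∀ i j, x i - y j ≠ 0 := fun i j => sub_ne_zero.mpr (hne i j)
  have hf : ∏ i, ∏ j, f c (x i) (y j) ≠ 0 :=
    Finset.prod_ne_zero_iff.mpr fun i _ => Finset.prod_ne_zero_iff.mpr fun j _ =>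
      div_ne_zero (hsh i j) (hsub i j)
  have hM : (Matrix.of fun i j =>
      (h c (x i) (y j))⁻¹ * ∏ l ∈ Finset.univ.erase j, (x i - y l) / c) =
      Matrix.of fun i j => (∏ l, (x i - y l) / c) *
        (Matrix.of fun i j => t c (x i) (y j)) i j := by
    ext i j
    simp only [Matrix.of_apply]
    rw [← Finset.mul_prod_erase Finset.univ _ (Finset.mem_univ j)]
    have h1 := hsub i j
    have h2 := hsh i j
    simp only [h, t]
    field_simp
  have hprod : (∏ i, ∏ j, h c (x i) (y j)) =
      (∏ i, ∏ l, (x i - y l) / c) * ∏ i, ∏ j, f c (x i) (y j) := by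
    simp only [← Finset.prod_mul_distrib]
    refine Finset.prod_congr rfl fun i _ => Finset.prod_congr rfl fun j _ => ?_
    have h1 := hsub i j
    simp only [h, f]
    field_simp
  rw [eq_div_iff hf, reducedIK, izerginKorepin, hM, Matrix.det_mul_column, hprod]
  ring

/-! ### Monodromy matrices and highest weight vectors -/

section Representation

variable {V : Type*} [AddCommGroup V] [Module ℂ V]

/-- The permutation matrix `P = ∑ e_ij ⊗ e_ji` on `ℂ³ ⊗ ℂ³`. -/
def permMatrix : Matrix (Fin 3 × Fin 3) (Fin 3 × Fin 3) ℂ :=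
  ∑ i : Fin 3, ∑ j : Fin 3, Matrix.single i j (1 : ℂ) ⊗ₖ Matrix.single j i (1 : ℂ)

/-- `(x - y) I + c P`, which is the rational `GL(3)`-invariant `R`-matrix
`R(x,y) = (I + g(x,y) P) / f(x,y)` multiplied by the scalar `x - y + c`.  The scalar cancels in the
`RTT` relation, and without it the relation makes sense at all pairs of points. -/
noncomputable def yangR (c x y : ℂ) : Matrix (Fin 3 × Fin 3) (Fin 3 × Fin 3) ℂ :=
  (x - y) • (1 : Matrix (Fin 3 × Fin 3) (Fin 3 × Fin 3) ℂ) + c • permMatrix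

/-- The matrix `T(z) = ∑ e_ij ⊗ T_ij(z)` with entries in `End V`. -/
def monodromy (T : Fin 3 → Fin 3 → ℂ → Module.End ℂ V) (z : ℂ) :
    Matrix (Fin 3) (Fin 3) (Module.End ℂ V) :=
  Matrix.of fun i j => T i j z

/-- The defining relation of the Yangian `Y(gl₃)`,
`R₁₂(x,y) T₁(x) T₂(y) = T₂(y) T₁(x) R₁₂(x,y)`, for operators `T_ij(z)` on `V`.
The indices `1, 2, 3` are `0, 1, 2` in `Fin 3`.  A representation whose `T_ij(z)` have poles is
covered: at a pole `z` put all nine `T_ij(z)` equal to `0`, which preserves the relation. -/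
def RTT (c : ℂ) (T : Fin 3 → Fin 3 → ℂ → Module.End ℂ V) : Prop :=
  ∀ x y : ℂ,
    let R := (yangR c x y).map (algebraMap ℂ (Module.End ℂ V))
    let T₁ := monodromy T x ⊗ₖ (1 : Matrix (Fin 3) (Fin 3) (Module.End ℂ V))
    let T₂ := (1 : Matrix (Fin 3) (Fin 3) (Module.End ℂ V)) ⊗ₖ monodromy T y
    R * T₁ * T₂ = T₂ * T₁ * R

/-- `vac` is a highest weight vector `|0⟩` with weights `λ_i(z)`: `T_ij(z)|0⟩ = 0` for `j < i` and
`T_ii(z)|0⟩ = λ_i(z)|0⟩`. -/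
def IsHighestWeight (T : Fin 3 → Fin 3 → ℂ → Module.End ℂ V) (lam : Fin 3 → ℂ → ℂ) (vac : V) :
    Prop :=
  (∀ i j : Fin 3, j < i → ∀ z, T i j z vac = 0) ∧ ∀ (i : Fin 3) (z : ℂ), T i i z vac = lam i z • vac

/-- The transfer matrix `t(w) = T₁₁(w) + T₂₂(w) + T₃₃(w)`. -/
def transferMatrix (T : Fin 3 → Fin 3 → ℂ → Module.End ℂ V) (w : ℂ) : Module.End ℂ V :=
  T 0 0 w + T 1 1 w + T 2 2 w

/-! ### Bethe vectors -/

/-- The product `X(x̄_S)` of the operators `X(x_i)`, `i ∈ S`, in increasing order of the index. -/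
def opProd (X : ℂ → Module.End ℂ V) {n : ℕ} (x : Fin n → ℂ) (S : Finset (Fin n)) :
    Module.End ℂ V :=
  ((S.sort (fun i j => i ≤ j)).map fun i => X (x i)).prod

/-- The coefficient
`K_k(v̄_I|ū_I) f(v̄_II,v̄_I) f(ū_I,ū_II) / (λ₂(v̄_II) λ₂(ū) f(v̄,ū))`
for `ū_I = (u_i)_{i ∈ I}`, `v̄_I = (v_j)_{j ∈ J}` with `#I = #J = k`.  In it
`f(v̄,ū) = f(v̄_I,ū_I) f(v̄_I,ū_II) f(v̄_II,ū)`, and the first factor is absorbed into `reducedIK`. -/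
noncomputable def bvCoeff (c : ℂ) (lam : Fin 3 → ℂ → ℂ) {a b : ℕ} (u : Fin a → ℂ) (v : Fin b → ℂ)
    (I : Finset (Fin a)) (J : Finset (Fin b)) (hIJ : J.card = I.card) : ℂ :=
  reducedIK c (fun k => v (J.orderEmbOfFin hIJ k)) (fun k => u (I.orderEmbOfFin rfl k)) *
      fProd c v Jᶜ v J * fProd c u I u Iᶜ /
    ((∏ j ∈ Jᶜ, lam 1 (v j)) * (∏ i, lam 1 (u i)) *
      (fProd c v J u Iᶜ * fProd c v Jᶜ u Finset.univ))

/-- If no `v_j` equals a `u_i`, the coefficient is literally the displayed one. -/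
theorem bvCoeff_eq (c : ℂ) (hc : c ≠ 0) (lam : Fin 3 → ℂ → ℂ) {a b : ℕ} (u : Fin a → ℂ)
    (v : Fin b → ℂ) (hne : ∀ i j, u i ≠ v j) (hsh : ∀ i j, v j - u i + c ≠ 0)
    (I : Finset (Fin a)) (J : Finset (Fin b)) (hIJ : J.card = I.card) :
    bvCoeff c lam u v I J hIJ =
      izerginKorepin c (fun k => v (J.orderEmbOfFin hIJ k)) (fun k => u (I.orderEmbOfFin rfl k)) *
          fProd c v Jᶜ v J * fProd c u I u Iᶜ /
        ((∏ j ∈ Jᶜ, lam 1 (v j)) * (∏ i, lam 1 (u i)) *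
          fProd c v Finset.univ u Finset.univ) := by
  have key : ∀ {n k : ℕ} (S : Finset (Fin n)) (hS : S.card = k) (F : Fin n → ℂ),
      ∏ q : Fin k, F (S.orderEmbOfFin hS q) = ∏ i ∈ S, F i := by
    intro n k S hS F
    rw [← Finset.prod_image (s := Finset.univ) (g := fun q => S.orderEmbOfFin hS q)
      (f := F) (fun p _ q _ hpq => (S.orderEmbOfFin hS).injective hpq)]
    rw [Finset.image_orderEmbOfFin_univ]
  have h1 : (∏ p : Fin I.card, ∏ q : Fin I.card,
      f c (v (J.orderEmbOfFin hIJ p)) (u (I.orderEmbOfFin rfl q))) = fProd c v J u I := by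
    rw [fProd, ← key J hIJ]
    exact Finset.prod_congr rfl fun p _ => key I rfl fun i => f c _ (u i)
  have h2 : fProd c v Finset.univ u Finset.univ =
      fProd c v J u I * (fProd c v J u Iᶜ * fProd c v Jᶜ u Finset.univ) := by
    simp only [fProd]
    rw [← Finset.prod_mul_prod_compl J, ← mul_assoc, ← Finset.prod_mul_distrib]
    simp only [Finset.prod_mul_prod_compl]
  rw [bvCoeff, reducedIK_eq c hc _ _ (fun p q => (hne _ _).symm) (fun p q => hsh _ _), h1, h2]
  simp only [div_eq_mul_inv, mul_inv]
  ring

/-- The Bethe vector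
`B^{a,b}(ū;v̄) = ∑ K_k(v̄_I|ū_I) / (λ₂(v̄_II) λ₂(ū)) · f(v̄_II,v̄_I) f(ū_I,ū_II) / f(v̄,ū) ·
  T₁₃(ū_I) T₁₂(ū_II) T₂₃(v̄_II) |0⟩`,
summed over the partitions `ū ⇒ {ū_I, ū_II}`, `v̄ ⇒ {v̄_I, v̄_II}` with `#ū_I = #v̄_I = k`. -/
noncomputable def betheVector (c : ℂ) (T : Fin 3 → Fin 3 → ℂ → Module.End ℂ V)
    (lam : Fin 3 → ℂ → ℂ) (vac : V) {a b : ℕ} (u : Fin a → ℂ) (v : Fin b → ℂ) : V :=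
  ∑ I : Finset (Fin a), ∑ J : Finset (Fin b),
    if hIJ : J.card = I.card then
      bvCoeff c lam u v I J hIJ •
        (opProd (T 0 2) u I * opProd (T 0 1) u Iᶜ * opProd (T 1 2) v Jᶜ) vac
    else 0

end Representation

/-! ### Bethe equations and the eigenvalue -/

/-- `r_k(z) = λ_k(z) / λ₂(z)`; `r₁`, `r₃` are `k = 0`, `k = 2`. -/
noncomputable def r (lam : Fin 3 → ℂ → ℂ) (k : Fin 3) (z : ℂ) : ℂ := lam k z / lam 1 z

/-- `f(x̄_j, x_j)`: the product over the `x_k` with `k ≠ j`. -/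
noncomputable def fLeft (c : ℂ) {n : ℕ} (x : Fin n → ℂ) (j : Fin n) : ℂ :=
  ∏ k ∈ Finset.univ.erase j, f c (x k) (x j)

/-- `f(x_j, x̄_j)`: the product over the `x_k` with `k ≠ j`. -/
noncomputable def fRight (c : ℂ) {n : ℕ} (x : Fin n → ℂ) (j : Fin n) : ℂ :=
  ∏ k ∈ Finset.univ.erase j, f c (x j) (x k)

/-- The Bethe equations
`r₁(u_i) f(ū_i,u_i) = f(u_i,ū_i) f(v̄,u_i)` and `r₃(v_j) f(v_j,v̄_j) = f(v_j,ū) f(v̄_j,v_j)`. -/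
def BetheEquations (c : ℂ) (lam : Fin 3 → ℂ → ℂ) {a b : ℕ} (u : Fin a → ℂ) (v : Fin b → ℂ) :
    Prop :=
  (∀ i, r lam 0 (u i) * fLeft c u i = fRight c u i * ∏ k, f c (v k) (u i)) ∧
    ∀ j, r lam 2 (v j) * fRight c v j = (∏ k, f c (v j) (u k)) * fLeft c v j

/-- `Λ(w;ū;v̄) = λ₁(w) f(ū,w) + λ₂(w) f(w,ū) f(v̄,w) + λ₃(w) f(w,v̄)`. -/
noncomputable def eigenvalue (c : ℂ) (lam : Fin 3 → ℂ → ℂ) {a b : ℕ} (u : Fin a → ℂ)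
    (v : Fin b → ℂ) (w : ℂ) : ℂ :=
  lam 0 w * (∏ i, f c (u i) w) + lam 1 w * (∏ i, f c w (u i)) * (∏ j, f c (v j) w) +
    lam 2 w * ∏ j, f c w (v j)

/-- `r₁(u_j) f(ū_j,u_j) / f(v̄,u_j) - f(u_j,ū_j)`. -/
noncomputable def offShellU (c : ℂ) (lam : Fin 3 → ℂ → ℂ) {a b : ℕ} (u : Fin a → ℂ)
    (v : Fin b → ℂ) (j : Fin a) : ℂ :=
  r lam 0 (u j) * (fLeft c u j / ∏ k, f c (v k) (u j)) - fRight c u j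

/-- `r₃(v_i) f(v_i,v̄_i) / f(v_i,ū) - f(v̄_i,v_i)`. -/
noncomputable def offShellV (c : ℂ) (lam : Fin 3 → ℂ → ℂ) {a b : ℕ} (u : Fin a → ℂ)
    (v : Fin b → ℂ) (i : Fin b) : ℂ :=
  r lam 2 (v i) * (fRight c v i / ∏ k, f c (v i) (u k)) - fLeft c v i

end GL3Bethe

namespace GL3Bethe

/-! ### Identities between the rational functions -/

section Scalars

variable (c : ℂ)

/-! Multiplying the Bethe vector by `λ₂(ū) λ₂(v̄) f(v̄,ū)` clears its denominators and gives a
vector `D(ū,v̄)` (`betheNum`) indexed by finite sets. The algebra rests on one recursion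
(`IsNested`): `D(ū ∪ {z}, v̄) = T₁₂(z) D(ū,v̄) + ∑_i λ₂(v_i) f(v̄_i,v_i) f(v_i,ū) g(v_i,z) T₁₃(z)
D(ū,v̄_i)`.

`T₁₁(w)` exchanges with `T₁₂` and `T₁₃` by the same two-term rule, so induction on `ū` gives its
action (`diagonal_action`). `T₂₂(w)` alone does not behave well, but the recursion step with
`T₂₂(w)`, `T₂₃(w)` in place of `T₁₂`, `T₁₃` does (`middle_action`). From this follows a dual
recursion, which adds a parameter to `v̄` by means of `T₂₃` and `T₁₃` (`IsNested.insert_right`). It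
is the first recursion with `ū` and `v̄` interchanged and `c` replaced by `-c`, so `diagonal_action`
also yields the action of `T₃₃(w)`. When the three actions are added (`transfer_action`), the terms
`T₁₃(w) D(ū_j,v̄_i)` combine by partial fractions.

That the explicit sum over partitions obeys the recursion (`betheNum_isNested`) is seen by moving
`T₁₂(z)` through `T₁₃(ū_I)`. Comparing coefficients leaves a recursion for the Izergin--Korepin
determinant (`reducedIK_recursion`, from Lagrange interpolation inside one column) and a partial
fraction expansion (`g_mul_prod_f`).

To return to Bethe vectors, one uses that a parameter `w` common to both sets must lie in `ū_I` and
in `v̄_I`, so that `T₁₃(w) D(ū_j,v̄_i)` is proportional to the Bethe vector of `{ū_j,w}`, `{v̄_i,w}`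
(`betheVector_of_common`). Under the Bethe equations the unwanted terms already vanish at the level
of `D`, where nothing is divided by `λ₂(w)`; hence part (2) holds for every `w` outside the two
sets. -/

theorem f_eq_one_add_g {x y : ℂ} (hxy : x ≠ y) : f c x y = 1 + g c x y := by
  have := sub_ne_zero.mpr hxy
  simp only [f, g]
  field_simp

/-- The symmetry between `ū` and `v̄`: what is proved for the first row at arbitrary `c` is reused
for the last column at `-c`. -/
theorem g_neg (x y : ℂ) : g (-c) x y = g c y x := by
  simp only [g]
  rw [← neg_sub y x, neg_div_neg_eq]

theorem f_neg (x y : ℂ) : f (-c) x y = f c y x := by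
  simp only [f]
  rw [← neg_sub y x, ← neg_add, neg_div_neg_eq]

theorem g_swap (x y : ℂ) : g c y x = -g c x y := by
  simp only [g]
  rw [← neg_sub x y, div_neg]

/-- This and the next two are three-point partial fractions, in the forms in which pairs of exchange
terms merge or split during the inductions. -/
theorem g_mul_f_exchange {x y z : ℂ} (hxy : x ≠ y) (hxz : x ≠ z) (hyz : y ≠ z) :
    g c x z * f c z y + g c y z * g c x y = g c x z * f c x y := by
  have h1 := sub_ne_zero.mpr hxy
  have h2 := sub_ne_zero.mpr hxz
  have h3 := sub_ne_zero.mpr hyz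
  have h4 := sub_ne_zero.mpr hyz.symm
  simp only [f, g]
  field_simp
  ring

theorem g_mul_f_split {x y z : ℂ} (hxy : x ≠ y) (hxz : x ≠ z) (hyz : y ≠ z) :
    g c x y * f c x z = f c y z * g c x y - g c y z * g c x z := by
  have h1 := sub_ne_zero.mpr hxy
  have h2 := sub_ne_zero.mpr hxz
  have h3 := sub_ne_zero.mpr hyz
  simp only [f, g]
  field_simp
  ring

theorem g_mul_f_shift {x y z : ℂ} (hxy : x ≠ y) (hxz : x ≠ z) (hyz : y ≠ z) :
    g c x z * f c y x = f c y z * g c x z - g c y z * g c x y := by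
  have h1 := sub_ne_zero.mpr hxy
  have h2 := sub_ne_zero.mpr hxz
  have h3 := sub_ne_zero.mpr hyz
  have h4 := sub_ne_zero.mpr hxy.symm
  simp only [f, g]
  field_simp
  ring

/-- The exchange symmetry of the two-particle weight. -/
theorem pair_exchange {i k x y : ℂ} (hik : i ≠ k) (hix : i ≠ x) (hiy : i ≠ y) (hkx : k ≠ x)
    (hky : k ≠ y) :
    f c k i * (g c i x * f c i y * g c k y - g c i y * f c i x * g c k x) +
      f c i k * (g c k x * f c k y * g c i y - g c k y * f c k x * g c i x) = 0 := by
  have h1 := sub_ne_zero.mpr hik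
  have h2 := sub_ne_zero.mpr hix
  have h3 := sub_ne_zero.mpr hiy
  have h4 := sub_ne_zero.mpr hkx
  have h5 := sub_ne_zero.mpr hky
  have h6 := sub_ne_zero.mpr hik.symm
  simp only [f, g]
  field_simp
  ring

/-- `λ(x_i) f(v̄_i, v_i) f(v_i, ū)` -/
noncomputable def rowWeight (lam : ℂ → ℂ) (u v : Finset ℂ) (i : ℂ) : ℂ :=
  lam i * (∏ k ∈ v.erase i, f c k i) * ∏ j ∈ u, f c i j

/-- `λ(u_j) f(v̄, u_j) f(u_j, ū_j)` -/
noncomputable def colWeight (lam : ℂ → ℂ) (u v : Finset ℂ) (j : ℂ) : ℂ :=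
  lam j * (∏ i ∈ v, f c i j) * ∏ k ∈ u.erase j, f c j k

variable (lam : ℂ → ℂ)

theorem rowWeight_neg (u v : Finset ℂ) (i : ℂ) :
    rowWeight (-c) lam u v i = colWeight c lam v u i := by
  simp only [rowWeight, colWeight, f_neg]
  ring

theorem rowWeight_insert_left {u : Finset ℂ} {z : ℂ} (hz : z ∉ u) (v : Finset ℂ) (i : ℂ) :
    rowWeight c lam (insert z u) v i = f c i z * rowWeight c lam u v i := by
  simp only [rowWeight, Finset.prod_insert hz]
  ring

theorem rowWeight_insert_right {v : Finset ℂ} {w i : ℂ} (hw : w ∉ v) (hi : i ∈ v)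
    (u : Finset ℂ) :
    rowWeight c lam u (insert w v) i = f c w i * rowWeight c lam u v i := by
  have hne : w ≠ i := fun h => hw (h ▸ hi)
  simp only [rowWeight, Finset.erase_insert_of_ne hne]
  rw [Finset.prod_insert (fun h => hw (Finset.mem_of_mem_erase h))]
  ring

theorem rowWeight_erase_left {u : Finset ℂ} {j : ℂ} (hj : j ∈ u) (v : Finset ℂ) (i : ℂ) :
    rowWeight c lam u v i = f c i j * rowWeight c lam (u.erase j) v i := by
  rw [← rowWeight_insert_left c lam (Finset.notMem_erase j u), Finset.insert_erase hj]

theorem colWeight_insert_left {u : Finset ℂ} {z j : ℂ} (hz : z ∉ u) (hj : j ∈ u)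
    (v : Finset ℂ) :
    colWeight c lam (insert z u) v j = f c j z * colWeight c lam u v j := by
  have := rowWeight_insert_right (-c) lam hz hj v
  simpa only [rowWeight_neg, f_neg] using this

theorem colWeight_erase_right {v : Finset ℂ} {i : ℂ} (hi : i ∈ v) (u : Finset ℂ) (j : ℂ) :
    colWeight c lam u v j = f c i j * colWeight c lam u (v.erase i) j := by
  have := rowWeight_erase_left (-c) lam hi u j
  simpa only [rowWeight_neg, f_neg] using this

theorem colWeight_insert_self {u : Finset ℂ} {z : ℂ} (hz : z ∉ u) (v : Finset ℂ) :
    colWeight c lam (insert z u) v z = lam z * (∏ i ∈ v, f c i z) * ∏ k ∈ u, f c z k := by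
  simp only [colWeight, Finset.erase_insert hz]

theorem rowWeight_insert_self {v : Finset ℂ} {w : ℂ} (hw : w ∉ v) (u : Finset ℂ) :
    rowWeight c lam u (insert w v) w = lam w * (∏ i ∈ v, f c i w) * ∏ k ∈ u, f c w k := by
  simp only [rowWeight, Finset.erase_insert hw]

/-- `s_i(u,v) s_k(u,v\i)` up to the symmetric factor is `f(k,i)`. -/
theorem rowWeight_mul_rowWeight {v : Finset ℂ} {i k : ℂ} (hk : k ∈ v)
    (hik : i ≠ k) (u : Finset ℂ) :
    rowWeight c lam u v i * rowWeight c lam u (v.erase i) k =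
      f c k i * (rowWeight c lam u (v.erase k) i * rowWeight c lam u (v.erase i) k) := by
  have hk' : k ∈ v.erase i := Finset.mem_erase.mpr ⟨hik.symm, hk⟩
  have : ∏ m ∈ v.erase i, f c m i = f c k i * ∏ m ∈ (v.erase k).erase i, f c m i := by
    rw [Finset.erase_right_comm, Finset.mul_prod_erase _ (fun m => f c m i) hk']
  simp only [rowWeight, this]
  ring

end Scalars

/-- A sum over ordered pairs of an antisymmetric function vanishes. -/
theorem sum_erase_eq_zero_of_antisymm {V : Type*} [AddCommGroup V] [Module ℂ V] (v : Finset ℂ)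
    (F : ℂ → ℂ → V) (hF : ∀ i ∈ v, ∀ k ∈ v, i ≠ k → F i k + F k i = 0) :
    ∑ i ∈ v, ∑ k ∈ v.erase i, F i k = 0 := by
  have hswap : ∑ i ∈ v, ∑ k ∈ v.erase i, F i k = ∑ i ∈ v, ∑ k ∈ v.erase i, F k i := by
    refine Finset.sum_comm' fun x y => ?_
    simp only [Finset.mem_erase]
    tauto
  have hsum : ∑ i ∈ v, ∑ k ∈ v.erase i, F i k + ∑ i ∈ v, ∑ k ∈ v.erase i, F i k = 0 := by
    nth_rewrite 2 [hswap]
    simp only [← Finset.sum_add_distrib]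
    refine Finset.sum_eq_zero fun i hi => Finset.sum_eq_zero fun k hk => ?_
    exact hF i hi k (Finset.mem_of_mem_erase hk) (Finset.ne_of_mem_erase hk).symm
  have h2 : (2 : ℂ) • ∑ i ∈ v, ∑ k ∈ v.erase i, F i k = 0 := by rw [two_smul, hsum]
  exact (smul_eq_zero.mp h2).resolve_left two_ne_zero

/-! ### The abstract nested recursion and the action of a diagonal operator on it. -/

section Raising

variable {V : Type*} [AddCommGroup V] [Module ℂ V] (c : ℂ) (lam : ℂ → ℂ)
  (A₂ A₃ B₂ B₃ : ℂ → Module.End ℂ V)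

/-- One step of the nested recursion: it adds the parameter `x`, carried by operators at `p`. -/
noncomputable def raise (u : Finset ℂ) (x p : ℂ) (Φ : Finset ℂ → V) (v : Finset ℂ) : V :=
  B₂ p (Φ v) + ∑ i ∈ v, (rowWeight c lam u v i * g c i x) • B₃ p (Φ (v.erase i))

/-- The weighted sum over a single removed parameter. -/
noncomputable def removeOne (u : Finset ℂ) (x : ℂ) (Φ : Finset ℂ → V) (v : Finset ℂ) : V :=
  ∑ i ∈ v, (rowWeight c lam u v i * g c i x) • Φ (v.erase i)

/-- The weighted sum over two removed parameters. -/
noncomputable def removeTwo (u : Finset ℂ) (x y : ℂ) (Φ : Finset ℂ → V) (v : Finset ℂ) : V :=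
  ∑ i ∈ v, ∑ k ∈ v.erase i,
    (rowWeight c lam u v i * rowWeight c lam u (v.erase i) k * (g c i x * f c i y * g c k y)) •
      Φ ((v.erase i).erase k)

/-- Antisymmetrizing the difference in the two removed parameters leaves one instance of
`pair_exchange` for each pair. -/
theorem removeTwo_comm (u : Finset ℂ) {x y : ℂ} (Φ : Finset ℂ → V) {v : Finset ℂ}
    (hx : x ∉ v) (hy : y ∉ v) :
    removeTwo c lam u x y Φ v = removeTwo c lam u y x Φ v := by
  rw [← sub_eq_zero]
  simp only [removeTwo, ← Finset.sum_sub_distrib, ← sub_smul]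
  refine sum_erase_eq_zero_of_antisymm v _ fun i hi k hk hik => ?_
  rw [Finset.erase_right_comm (a := k) (b := i), ← add_smul]
  have hix : i ≠ x := fun h => hx (h ▸ hi)
  have hiy : i ≠ y := fun h => hy (h ▸ hi)
  have hkx : k ≠ x := fun h => hx (h ▸ hk)
  have hky : k ≠ y := fun h => hy (h ▸ hk)
  rw [rowWeight_mul_rowWeight c lam hk hik, rowWeight_mul_rowWeight c lam hi hik.symm]
  have := pair_exchange c hik hix hiy hkx hky
  convert zero_smul ℂ _ using 2
  linear_combination
    (rowWeight c lam u (v.erase k) i * rowWeight c lam u (v.erase i) k) * this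

/-- A normal form for two consecutive steps. The outer weight refers to `insert y u` and so carries
an extra `f(v_i,y)`; partial fractions split `g(v_i,x) f(v_i,y)` into sums that involve only `x` or
only `y`. -/
theorem raise_raise {u : Finset ℂ} {x y : ℂ} (hxy : x ≠ y) (hyu : y ∉ u) (p q : ℂ)
    (Φ : Finset ℂ → V) {v : Finset ℂ} (hx : x ∉ v) (hy : y ∉ v) :
    raise c lam A₂ A₃ (insert y u) x p (raise c lam B₂ B₃ u y q Φ) v =
      A₂ p (B₂ q (Φ v)) + A₂ p (B₃ q (removeOne c lam u y Φ v)) +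
      A₃ p (B₂ q (f c x y • removeOne c lam u x Φ v - g c x y • removeOne c lam u y Φ v)) +
      A₃ p (B₃ q (removeTwo c lam u x y Φ v)) := by
  have hmix : f c x y • removeOne c lam u x Φ v - g c x y • removeOne c lam u y Φ v =
      ∑ i ∈ v, (rowWeight c lam (insert y u) v i * g c i x) • Φ (v.erase i) := by
    simp only [removeOne, Finset.smul_sum, ← Finset.sum_sub_distrib, smul_smul, ← sub_smul]
    refine Finset.sum_congr rfl fun i hi => ?_
    have hix : i ≠ x := fun h => hx (h ▸ hi)
    have hiy : i ≠ y := fun h => hy (h ▸ hi)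
    rw [rowWeight_insert_left c lam hyu]
    congr 1
    linear_combination (-rowWeight c lam u v i) * g_mul_f_split c hix hiy hxy
  rw [hmix]
  have htwo : ∀ i k, rowWeight c lam (insert y u) v i * g c i x *
      (rowWeight c lam u (v.erase i) k * g c k y) =
      rowWeight c lam u v i * rowWeight c lam u (v.erase i) k *
        (g c i x * f c i y * g c k y) := fun i k => by
    rw [rowWeight_insert_left c lam hyu]
    ring
  simp only [raise, removeOne, removeTwo, map_add, map_sum, map_smul, smul_add,
    Finset.sum_add_distrib, Finset.smul_sum, smul_smul, htwo]
  abel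

theorem raise_congr (u : Finset ℂ) (x p : ℂ) {Φ Ψ : Finset ℂ → V} {v : Finset ℂ}
    (h : Φ v = Ψ v) (h' : ∀ i ∈ v, Φ (v.erase i) = Ψ (v.erase i)) :
    raise c lam B₂ B₃ u x p Φ v = raise c lam B₂ B₃ u x p Ψ v := by
  simp only [raise, h]
  congr 1
  exact Finset.sum_congr rfl fun i hi => by rw [h' i hi]

theorem raise_add (u : Finset ℂ) (x p : ℂ) (Φ Ψ : Finset ℂ → V) (v : Finset ℂ) :
    raise c lam B₂ B₃ u x p (fun v' => Φ v' + Ψ v') v =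
      raise c lam B₂ B₃ u x p Φ v + raise c lam B₂ B₃ u x p Ψ v := by
  simp only [raise, map_add, smul_add, Finset.sum_add_distrib]
  abel

theorem raise_smul (u : Finset ℂ) (x p a : ℂ) (Φ : Finset ℂ → V) (v : Finset ℂ) :
    raise c lam B₂ B₃ u x p (fun v' => a • Φ v') v = a • raise c lam B₂ B₃ u x p Φ v := by
  simp only [raise, map_smul, smul_add, Finset.smul_sum, smul_comm a]

theorem raise_sum {ι : Type*} (u : Finset ℂ) (x p : ℂ) (s : Finset ι) (Φ : ι → Finset ℂ → V)
    (v : Finset ℂ) :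
    raise c lam B₂ B₃ u x p (fun v' => ∑ j ∈ s, Φ j v') v =
      ∑ j ∈ s, raise c lam B₂ B₃ u x p (Φ j) v := by
  simp only [raise, map_sum, Finset.smul_sum, Finset.sum_add_distrib]
  rw [Finset.sum_comm]

/-- The operators in the first row exchange like `B₂`, `B₃` here. -/
structure RowExchange : Prop where
  comm₂ : ∀ p q φ, B₂ p (B₂ q φ) = B₂ q (B₂ p φ)
  comm₃ : ∀ p q φ, B₃ p (B₃ q φ) = B₃ q (B₃ p φ)
  exchange : ∀ p q, p ≠ q → ∀ φ,
    B₂ p (B₃ q φ) = f c q p • B₃ q (B₂ p φ) + g c p q • B₃ p (B₂ q φ)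

variable {B₂ B₃} in
-- Pulling a diagonal operator at `w` through a step at `z` gives two exchange terms for each `j`;
-- this merges them into one where the operators of `j` sit at `w`. By `raise_raise` and the
-- symmetry of `removeTwo`, it reduces to comparing coefficients of operator products in a fixed
-- order.
theorem raise_exchange (hB : RowExchange c B₂ B₃) {u : Finset ℂ} {z w j : ℂ} (hzw : z ≠ w)
    (hzj : z ≠ j) (hwj : w ≠ j) (hzu : z ∉ u) (hju : j ∉ u) (Φ : Finset ℂ → V) {v : Finset ℂ}
    (hz : z ∉ v) (hj : j ∉ v) :
    (f c z w * g c w j) • raise c lam B₂ B₃ (insert j u) z z (raise c lam B₂ B₃ u j w Φ) v +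
      (g c w z * g c z j) • raise c lam B₂ B₃ (insert j u) z w (raise c lam B₂ B₃ u j z Φ) v =
      (g c w j * f c z j) •
        raise c lam B₂ B₃ (insert z u) j w (raise c lam B₂ B₃ u z z Φ) v := by
  rw [raise_raise c lam B₂ B₃ B₂ B₃ hzj hju _ _ _ hz hj, raise_raise c lam B₂ B₃ B₂ B₃ hzj hju _ _ _ hz hj,
    raise_raise c lam B₂ B₃ B₂ B₃ hzj.symm hzu _ _ _ hj hz, removeTwo_comm c lam u Φ hj hz,
    hB.comm₂ z w, hB.comm₃ z w, hB.exchange z w hzw, hB.exchange w z hzw.symm,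
    hB.exchange w z hzw.symm]
  simp only [map_sub, map_smul]
  have h1 := sub_ne_zero.mpr hzw
  have h2 := sub_ne_zero.mpr hzj
  have h3 := sub_ne_zero.mpr hwj
  have h4 := sub_ne_zero.mpr hzw.symm
  have h5 := sub_ne_zero.mpr hzj.symm
  match_scalars <;> simp only [f, g] <;> field_simp <;> ring

/-- A family of vectors that satisfies the nested recursion in its first argument. -/
def IsNested (D : Finset ℂ → Finset ℂ → V) : Prop :=
  ∀ z u v, z ∉ u → Disjoint (insert z u) v →
    D (insert z u) v = raise c lam B₂ B₃ u z z (D u) v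

variable {B₂ B₃} in
/-- The action of an operator that exchanges like `T₁₁` with the first row. -/
theorem diagonal_action (hB : RowExchange c B₂ B₃) {D : Finset ℂ → Finset ℂ → V}
    (hD : IsNested c lam B₂ B₃ D) (A : ℂ → Module.End ℂ V) (mu : ℂ → ℂ)
    (hA₂ : ∀ w z, w ≠ z → ∀ φ, A w (B₂ z φ) = f c z w • B₂ z (A w φ) + g c w z • B₂ w (A z φ))
    (hA₃ : ∀ w z, w ≠ z → ∀ φ, A w (B₃ z φ) = f c z w • B₃ z (A w φ) + g c w z • B₃ w (A z φ))
    (hbase : ∀ w v, w ∉ v → A w (D ∅ v) = mu w • D ∅ v) (u : Finset ℂ) :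
    ∀ (v : Finset ℂ) (w : ℂ), Disjoint u v → w ∉ u → w ∉ v →
      A w (D u v) = (mu w * ∏ j ∈ u, f c j w) • D u v +
        ∑ j ∈ u, (g c w j * (mu j * ∏ k ∈ u.erase j, f c k j)) •
          raise c lam B₂ B₃ (u.erase j) j w (D (u.erase j)) v := by
  induction u using Finset.induction_on with
  | empty =>
    intro v w _ _ hw
    simp [hbase w v hw]
  | insert z u hzu ih =>
    intro v w huv hw hwv
    have hwz : w ≠ z := fun h => hw (h ▸ Finset.mem_insert_self _ _)
    have hwu : w ∉ u := fun h => hw (Finset.mem_insert_of_mem h)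
    have huv' : Disjoint u v := huv.mono_left (Finset.subset_insert _ _)
    have hzv : z ∉ v := Finset.disjoint_left.mp huv (Finset.mem_insert_self _ _)
    have herase : ∀ i, Disjoint u (v.erase i) := fun i =>
      huv'.mono_right (Finset.erase_subset _ _)
    have hnot : ∀ {x} i, x ∉ v → x ∉ v.erase i := fun i hx h => hx (Finset.mem_of_mem_erase h)
    set b : ℂ → ℂ := fun j => mu j * ∏ k ∈ u.erase j, f c k j with hb
    set E : ℂ → ℂ → Finset ℂ → V := fun j p =>
      raise c lam B₂ B₃ (u.erase j) j p (D (u.erase j)) with hE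
    -- The induction hypothesis is applied under `raise`, hence at `v` and at each `v.erase i`; this
    -- is why `v` is quantified inside the induction.
    have hraise : ∀ x p, x ∉ u → x ∉ v → raise c lam B₂ B₃ u z p (fun v' => A x (D u v')) v =
        (mu x * ∏ j ∈ u, f c j x) • raise c lam B₂ B₃ u z p (D u) v +
          ∑ j ∈ u, (g c x j * b j) • raise c lam B₂ B₃ u z p (E j x) v := by
      intro x p hxu hxv
      simp only [← raise_smul, ← raise_sum, ← raise_add]
      exact raise_congr _ _ _ _ _ _ _ (ih v x huv' hxu hxv)
        fun i _ => ih _ x (herase i) hxu (hnot i hxv)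
    have hstep : A w (D (insert z u) v) =
        f c z w • raise c lam B₂ B₃ u z z (fun v' => A w (D u v')) v +
          g c w z • raise c lam B₂ B₃ u z w (fun v' => A z (D u v')) v := by
      rw [hD z u v hzu huv]
      simp only [raise, map_add, map_sum, map_smul, hA₂ w z hwz, hA₃ w z hwz, smul_add,
        Finset.smul_sum, Finset.sum_add_distrib, smul_comm (f c z w), smul_comm (g c w z)]
      abel
    -- The unwanted term of each old `j` is opened once by the recursion in `z` and then split by
    -- `raise_exchange`.
    have hterm : ∀ j ∈ u,
        (g c w j * (mu j * ∏ k ∈ (insert z u).erase j, f c k j)) •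
          raise c lam B₂ B₃ ((insert z u).erase j) j w (D ((insert z u).erase j)) v =
        (f c z w * (g c w j * b j)) • raise c lam B₂ B₃ u z z (E j w) v +
          (g c w z * (g c z j * b j)) • raise c lam B₂ B₃ u z w (E j z) v := by
      intro j hj
      have hzj : z ≠ j := fun h => hzu (h ▸ hj)
      have hwj : w ≠ j := fun h => hwu (h ▸ hj)
      have hju : j ∉ u.erase j := Finset.notMem_erase j u
      have hzu' : z ∉ u.erase j := fun h => hzu (Finset.mem_of_mem_erase h)
      have hjv : j ∉ v := Finset.disjoint_left.mp huv' hj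
      have hex := raise_exchange c lam hB hwz.symm hzj hwj hzu' hju (D (u.erase j)) hzv hjv
      rw [Finset.insert_erase hj] at hex
      have hdis : ∀ v' ⊆ v, Disjoint (insert z (u.erase j)) v' := fun v' hv' =>
        (huv.mono_left (Finset.insert_subset_insert z (Finset.erase_subset j u))).mono_right hv'
      have hD' : raise c lam B₂ B₃ (insert z (u.erase j)) j w (D (insert z (u.erase j))) v =
          raise c lam B₂ B₃ (insert z (u.erase j)) j w
            (raise c lam B₂ B₃ (u.erase j) z z (D (u.erase j))) v :=
        raise_congr _ _ _ _ _ _ _ (hD z _ v hzu' (hdis v subset_rfl))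
          fun i _ => hD z _ _ hzu' (hdis _ (Finset.erase_subset i v))
      rw [Finset.erase_insert_of_ne hzj, hD', Finset.prod_insert hzu']
      calc _ = b j • ((g c w j * f c z j) • raise c lam B₂ B₃ (insert z (u.erase j)) j w
            (raise c lam B₂ B₃ (u.erase j) z z (D (u.erase j))) v) := by
            rw [smul_smul]
            congr 1
            simp only [hb]
            ring
        _ = _ := by
            rw [← hex, smul_add, smul_smul, smul_smul]
            congr 2 <;> ring
    rw [hstep, hraise w z hwu hwv, hraise z w hzu hzv, Finset.sum_insert hzu,
      Finset.erase_insert hzu, Finset.prod_insert hzu, Finset.sum_congr rfl hterm,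
      Finset.sum_add_distrib, hD z u v hzu huv]
    simp only [smul_add, smul_smul, Finset.smul_sum]
    rw [show f c z w * (mu w * ∏ j ∈ u, f c j w) = mu w * (f c z w * ∏ j ∈ u, f c j w) by ring]
    abel

end Raising

/-! ### Exchange relations of the monodromy entries. -/

section Commutation

variable {V : Type*} [AddCommGroup V] [Module ℂ V] {c : ℂ}
  {T : Fin 3 → Fin 3 → ℂ → Module.End ℂ V}

theorem permMatrix_apply (a b : Fin 3 × Fin 3) :
    permMatrix a b = if a = b.swap then 1 else 0 := by
  obtain ⟨a₁, a₂⟩ := a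
  obtain ⟨b₁, b₂⟩ := b
  simp only [permMatrix, Matrix.sum_apply, Matrix.kroneckerMap_apply, Matrix.single_apply]
  rw [Finset.sum_eq_single a₁, Finset.sum_eq_single b₁]
  · simp only [and_true, Prod.swap_prod_mk, Prod.mk.injEq, mul_ite, mul_one, mul_zero,
      ← ite_and, eq_comm (a := b₁)]
    simp only [and_comm]
  · intro i _ hi
    simp [hi]
  · simp
  · intro i _ hi
    simp [hi]
  · simp

/-- The `((i,k),(j,l))` entry of the matrix relation. Without division by `x - y` it remains usable
at all pairs of points. -/
theorem RTT.commutator (hT : RTT c T) (x y : ℂ) (i j k l : Fin 3) :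
    (x - y) • (T i j x * T k l y) + c • (T k j x * T i l y) =
      (x - y) • (T k l y * T i j x) + c • (T k j y * T i l x) := by
  have h := congr_fun (congr_fun (hT x y) (i, k)) (j, l)
  simp only [yangR] at h
  simp [Matrix.mul_apply, Fintype.sum_prod_type, monodromy, permMatrix_apply,
    Matrix.kroneckerMap_apply, Matrix.one_apply] at h
  simp only [apply_ite (algebraMap ℂ (Module.End ℂ V)), map_zero, add_mul, mul_add, ite_mul,
    mul_ite, zero_mul, mul_zero, Finset.sum_add_distrib, ite_and, Finset.sum_ite_eq,
    Finset.sum_ite_eq', Finset.mem_univ, if_true, Finset.sum_const_zero, Finset.sum_ite_irrel] at h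
  rw [← Algebra.commutes, ← Algebra.commutes] at h
  simpa only [Algebra.smul_def, mul_assoc] using h

theorem RTT.apply_apply (hT : RTT c T) {x y : ℂ} (hxy : x ≠ y) (i j k l : Fin 3) (φ : V) :
    T i j x (T k l y φ) = T k l y (T i j x φ) +
      g c x y • (T k j y (T i l x φ) - T k j x (T i l y φ)) := by
  have h1 := sub_ne_zero.mpr hxy
  have h := LinearMap.congr_fun (hT.commutator x y i j k l) φ
  simp only [LinearMap.add_apply, LinearMap.smul_apply, Module.End.mul_apply] at h
  have h' : (x - y)⁻¹ • ((x - y) • T i j x (T k l y φ)) =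
      (x - y)⁻¹ • ((x - y) • T k l y (T i j x φ) +
        c • (T k j y (T i l x φ) - T k j x (T i l y φ))) := by
    rw [smul_sub, ← add_sub_assoc, ← h, add_sub_cancel_right]
  rwa [inv_smul_smul₀ h1, smul_add, inv_smul_smul₀ h1, smul_smul, inv_mul_eq_div] at h'

/-- The relation says that `x - y + c` times the commutator vanishes, and the same with `y - x + c`.
The sum of the two factors is `2c`, so no exceptional points remain. -/
theorem RTT.commute_same (hT : RTT c T) (hc : c ≠ 0) (i j : Fin 3) (x y : ℂ) (φ : V) :
    T i j x (T i j y φ) = T i j y (T i j x φ) := by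
  have h := LinearMap.congr_fun (hT.commutator x y i j i j) φ
  have h' := LinearMap.congr_fun (hT.commutator y x i j i j) φ
  simp only [LinearMap.add_apply, LinearMap.smul_apply, Module.End.mul_apply] at h h'
  have h2 : (2 * c) • (T i j x (T i j y φ) - T i j y (T i j x φ)) = 0 := by
    linear_combination (norm := module) h - h'
  exact sub_eq_zero.mp ((smul_eq_zero.mp h2).resolve_left (mul_ne_zero two_ne_zero hc))

theorem RTT.rowExchange_first (hT : RTT c T) (hc : c ≠ 0) :
    RowExchange c (T 0 1) (T 0 2) where
  comm₂ p q φ := hT.commute_same hc 0 1 p q φ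
  comm₃ p q φ := hT.commute_same hc 0 2 p q φ
  exchange p q hpq φ := by
    have h := hT.apply_apply hpq.symm 0 2 0 1 φ
    rw [f_eq_one_add_g c hpq.symm]
    rw [g_swap c p q] at h ⊢
    linear_combination (norm := module) (-1 : ℂ) • h

/-- The arguments of `f` and `g` come out reversed in comparison with the first row, which is what
`-c` records. -/
theorem RTT.rowExchange_last (hT : RTT c T) (hc : c ≠ 0) :
    RowExchange (-c) (T 1 2) (T 0 2) where
  comm₂ p q φ := hT.commute_same hc 1 2 p q φ
  comm₃ p q φ := hT.commute_same hc 0 2 p q φ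
  exchange p q hpq φ := by
    have h := hT.apply_apply hpq 1 2 0 2 φ
    rw [f_neg, g_neg, f_eq_one_add_g c hpq, g_swap c p q]
    linear_combination (norm := module) h

theorem RTT.diag_apply_row (hT : RTT c T) (i j : Fin 3) {w z : ℂ} (hwz : w ≠ z) (φ : V) :
    T i i w (T i j z φ) = f c z w • T i j z (T i i w φ) + g c w z • T i j w (T i i z φ) := by
  have h := hT.apply_apply hwz.symm i j i i φ
  rw [f_eq_one_add_g c hwz.symm, g_swap c z w]
  linear_combination (norm := module) (-1 : ℂ) • h

theorem RTT.diag_apply_col (hT : RTT c T) (i j : Fin 3) {w z : ℂ} (hwz : w ≠ z) (φ : V) :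
    T j j w (T i j z φ) =
      f (-c) z w • T i j z (T j j w φ) + g (-c) w z • T i j w (T j j z φ) := by
  have h := hT.apply_apply hwz j j i j φ
  rw [f_neg, g_neg, f_eq_one_add_g c hwz, g_swap c w z]
  linear_combination (norm := module) h

end Commutation

/-! ### Passing `T₂₂` and `T₂₃` through one step of the recursion. -/

section DiagonalActions

variable {V : Type*} [AddCommGroup V] [Module ℂ V] {c : ℂ}
  {T : Fin 3 → Fin 3 → ℂ → Module.End ℂ V} (lam : ℂ → ℂ)

/-- `T₂₂` past `T₁₃` produces `T₁₂ T₂₃`, and `T₂₃` past `T₁₂` produces `T₁₃ T₂₂`. Neither closes by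
itself; the step formed with both operators does. -/
theorem raise_exchange_diag (hT : RTT c T) {u : Finset ℂ} {z w : ℂ} (hwz : w ≠ z)
    (hzu : z ∉ u) (hwu : w ∉ u) (Φ : Finset ℂ → V) {v : Finset ℂ} (hz : z ∉ v) (hw : w ∉ v) :
    raise c lam (T 1 1) (T 1 2) (insert z u) w w (raise c lam (T 0 1) (T 0 2) u z z Φ) v =
      f c w z • raise c lam (T 0 1) (T 0 2) (insert w u) z z
        (raise c lam (T 1 1) (T 1 2) u w w Φ) v -
      g c w z • raise c lam (T 0 1) (T 0 2) (insert z u) w w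
        (raise c lam (T 1 1) (T 1 2) u z z Φ) v := by
  rw [raise_raise c lam _ _ _ _ hwz hzu _ _ _ hw hz,
    raise_raise c lam _ _ _ _ hwz.symm hwu _ _ _ hz hw,
    raise_raise c lam _ _ _ _ hwz hzu _ _ _ hw hz, removeTwo_comm c lam u Φ hz hw]
  rw [hT.apply_apply hwz 1 1 0 1, hT.apply_apply hwz 1 1 0 2, hT.apply_apply hwz 1 2 0 1,
    hT.apply_apply hwz 1 2 0 2]
  simp only [map_sub, map_smul]
  have h1 := sub_ne_zero.mpr hwz
  have h2 := sub_ne_zero.mpr hwz.symm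
  match_scalars <;> simp only [f, g] <;> field_simp <;> ring

/-- The exchange terms assemble into steps with `T₂₂`, `T₂₃`, which `middle_action` evaluates. The
factor `f(w,i)` in the sum is the one by which the weight of `i` grows when `w` joins `v`. -/
theorem apply_raise (hT : RTT c T) {u : Finset ℂ} {z w : ℂ} (hwz : w ≠ z)
    (Φ : Finset ℂ → V) {v : Finset ℂ} (hz : z ∉ v) (hw : w ∉ v) :
    T 1 2 w (raise c lam (T 0 1) (T 0 2) u z z Φ v) =
      T 0 1 z (T 1 2 w (Φ v)) +
      ∑ i ∈ v, (rowWeight c lam u v i * g c i z * f c w i) • T 0 2 z (T 1 2 w (Φ (v.erase i))) +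
      g c w z • (T 0 2 z (raise c lam (T 1 1) (T 1 2) u w w Φ v) -
        T 0 2 w (raise c lam (T 1 1) (T 1 2) u z z Φ v)) := by
  have hsum : ∑ i ∈ v, (rowWeight c lam u v i * g c i z * f c w i) •
      T 0 2 z (T 1 2 w (Φ (v.erase i))) =
      f c w z • T 0 2 z (T 1 2 w (removeOne c lam u z Φ v)) -
        g c w z • T 0 2 z (T 1 2 w (removeOne c lam u w Φ v)) := by
    simp only [removeOne, map_sum, map_smul, Finset.smul_sum, ← Finset.sum_sub_distrib, smul_smul,
      ← sub_smul]
    refine Finset.sum_congr rfl fun i hi => ?_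
    have hiz : i ≠ z := fun h => hz (h ▸ hi)
    have hiw : i ≠ w := fun h => hw (h ▸ hi)
    congr 1
    linear_combination rowWeight c lam u v i * g_mul_f_shift c hiw hiz hwz
  have hraise : ∀ (A₂ A₃ : ℂ → Module.End ℂ V) (x p : ℂ), raise c lam A₂ A₃ u x p Φ v =
      A₂ p (Φ v) + A₃ p (removeOne c lam u x Φ v) := by
    intro A₂ A₃ x p
    simp only [raise, removeOne, map_sum, map_smul]
  rw [hsum, hraise, hraise, hraise, map_add, hT.apply_apply hwz 1 2 0 1,
    hT.apply_apply hwz 1 2 0 2, f_eq_one_add_g c hwz]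
  simp only [map_add]
  module

end DiagonalActions

/-! ### The action of `T₂₂` completed by `T₂₃` terms. -/

section LowerActions

variable {V : Type*} [AddCommGroup V] [Module ℂ V] {c : ℂ}
  {T : Fin 3 → Fin 3 → ℂ → Module.End ℂ V} {lam : ℂ → ℂ}

theorem IsNested.raise_eq {D : Finset ℂ → Finset ℂ → V} {B₂ B₃ : ℂ → Module.End ℂ V}
    (hD : IsNested c lam B₂ B₃ D) (A₂ A₃ : ℂ → Module.End ℂ V) (u' : Finset ℂ) (x p : ℂ)
    {z : ℂ} {u v : Finset ℂ} (hz : z ∉ u) (hzv : z ∉ v) (huv : Disjoint u v) :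
    raise c lam A₂ A₃ u' x p (D (insert z u)) v =
      raise c lam A₂ A₃ u' x p (raise c lam B₂ B₃ u z z (D u)) v := by
  have hdis : Disjoint (insert z u) v := Finset.disjoint_insert_left.mpr ⟨hzv, huv⟩
  exact raise_congr _ _ _ _ _ _ _ (hD z u v hz hdis)
    fun i _ => hD z u _ hz (hdis.mono_right (Finset.erase_subset i v))

/-- The action of `T₂₂(w)`, with the terms where `w` replaces some `v_i` on the left. -/
theorem middle_action (hT : RTT c T) {D : Finset ℂ → Finset ℂ → V}
    (hD : IsNested c lam (T 0 1) (T 0 2) D)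
    (hbase : ∀ w v, w ∉ v →
      raise c lam (T 1 1) (T 1 2) ∅ w w (D ∅) v = (lam w * ∏ i ∈ v, f c i w) • D ∅ v)
    (u : Finset ℂ) : ∀ (v : Finset ℂ) (w : ℂ), Disjoint u v → w ∉ u → w ∉ v →
      raise c lam (T 1 1) (T 1 2) u w w (D u) v =
        (lam w * (∏ i ∈ v, f c i w) * ∏ j ∈ u, f c w j) • D u v -
          ∑ j ∈ u, (g c w j * colWeight c lam u v j) • D (insert w (u.erase j)) v := by
  induction u using Finset.induction_on with
  | empty =>
    intro v w _ _ hw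
    simp [hbase w v hw]
  | insert z u hzu ih =>
    intro v w huv hw hwv
    have hwz : w ≠ z := fun h => hw (h ▸ Finset.mem_insert_self _ _)
    have hwu : w ∉ u := fun h => hw (Finset.mem_insert_of_mem h)
    have huv' : Disjoint u v := huv.mono_left (Finset.subset_insert _ _)
    have hzv : z ∉ v := Finset.disjoint_left.mp huv (Finset.mem_insert_self _ _)
    -- A step at `y` applied to the induction hypothesis at `x`. The weights over `insert x u`
    -- supply the factors `f(v_i,x)` that the products over `v.erase i` lack, so the scalars no
    -- longer depend on `i` and the sum is again a value of `D`.
    have key : ∀ x y, x ≠ y → x ∉ u → x ∉ v → y ∉ u → y ∉ v →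
        raise c lam (T 0 1) (T 0 2) (insert x u) y y
          (raise c lam (T 1 1) (T 1 2) u x x (D u)) v =
        (lam x * (∏ i ∈ v, f c i x) * ∏ j ∈ u, f c x j) • D (insert y u) v -
          ∑ j ∈ u, (g c x j * colWeight c lam u v j) • D (insert y (insert x (u.erase j))) v := by
      intro x y hxy hxu hxv hyu hyv
      rw [hD y u v hyu (Finset.disjoint_insert_left.mpr ⟨hyv, huv'⟩)]
      have hDj : ∀ j ∈ u, D (insert y (insert x (u.erase j))) v =
          raise c lam (T 0 1) (T 0 2) (insert x (u.erase j)) y y (D (insert x (u.erase j))) v := by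
        intro j _
        refine hD y _ v ?_ ?_
        · simp only [Finset.mem_insert, Finset.mem_erase, not_or, not_and]
          exact ⟨hxy.symm, fun _ => hyu⟩
        · simp only [Finset.disjoint_insert_left]
          exact ⟨hyv, hxv, huv'.mono_left (Finset.erase_subset j u)⟩
      rw [Finset.sum_congr rfl fun j hj => by rw [hDj j hj]]
      rw [raise_congr c lam _ _ _ _ _ (Ψ := fun v' =>
        (lam x * (∏ i ∈ v', f c i x) * ∏ j ∈ u, f c x j) • D u v' -
          ∑ j ∈ u, (g c x j * colWeight c lam u v' j) • D (insert x (u.erase j)) v')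
        (ih v x huv' hxu hxv) fun i _ => ih (v.erase i) x
          (huv'.mono_right (Finset.erase_subset i v)) hxu
          fun h => hxv (Finset.mem_of_mem_erase h)]
      simp only [raise]
      simp only [map_sub, map_sum, map_smul, smul_sub, smul_add, Finset.smul_sum, smul_smul,
        Finset.sum_add_distrib, Finset.sum_sub_distrib]
      rw [Finset.sum_comm (s := v) (t := u)]
      have e1 : ∀ i ∈ v, rowWeight c lam (insert x u) v i * g c i y *
          (lam x * (∏ k ∈ v.erase i, f c k x) * ∏ j ∈ u, f c x j) =
          lam x * (∏ i ∈ v, f c i x) * (∏ j ∈ u, f c x j) *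
            (rowWeight c lam u v i * g c i y) := fun i hi => by
        rw [rowWeight_insert_left c lam hxu, ← Finset.mul_prod_erase v (fun k => f c k x) hi]
        ring
      have e2 : ∀ j ∈ u, ∀ i ∈ v, rowWeight c lam (insert x u) v i * g c i y *
          (g c x j * colWeight c lam u (v.erase i) j) =
          g c x j * colWeight c lam u v j *
            (rowWeight c lam (insert x (u.erase j)) v i * g c i y) := fun j hj i hi => by
        rw [rowWeight_insert_left c lam hxu, rowWeight_insert_left c lam
          (fun h => hxu (Finset.mem_of_mem_erase h)), rowWeight_erase_left c lam hj,
          colWeight_erase_right c lam hi]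
        ring
      rw [Finset.sum_congr (s₁ := v) rfl fun i hi => by rw [e1 i hi],
        Finset.sum_congr rfl fun j hj => Finset.sum_congr rfl fun i hi => by rw [e2 j hj i hi]]
      abel
    rw [hD.raise_eq _ _ _ _ _ hzu hzv huv', raise_exchange_diag lam hT hwz hzu hwu _ hzv hwv,
      key w z hwz hwu hwv hzu hzv, key z w hwz.symm hzu hzv hwu hwv, Finset.sum_insert hzu,
      Finset.erase_insert hzu, colWeight_insert_self c lam hzu, Finset.prod_insert hzu]
    -- Adding `z` and `w` in either order leads to the same set, hence to the same value of `D`;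
    -- only the scalars have to be combined.
    have hj : ∀ j ∈ u, (g c w j * colWeight c lam (insert z u) v j) •
        D (insert w ((insert z u).erase j)) v =
        f c w z • (g c w j * colWeight c lam u v j) • D (insert z (insert w (u.erase j))) v -
          g c w z • (g c z j * colWeight c lam u v j) •
            D (insert w (insert z (u.erase j))) v := fun j hj => by
      have hzj : z ≠ j := fun h => hzu (h ▸ hj)
      have hwj : w ≠ j := fun h => hwu (h ▸ hj)
      rw [Finset.erase_insert_of_ne hzj, colWeight_insert_left c lam hzu hj,
        Finset.insert_comm z w, smul_smul, smul_smul, ← sub_smul]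
      congr 1
      linear_combination colWeight c lam u v j * g_mul_f_exchange c hwz hwj hzj
    rw [Finset.sum_congr rfl hj, Finset.sum_sub_distrib, ← Finset.smul_sum, ← Finset.smul_sum]
    module

end LowerActions

/-! ### The recursion that adds a parameter to the second set. -/

section DualRecursion

variable {V : Type*} [AddCommGroup V] [Module ℂ V] {c : ℂ}
  {T : Fin 3 → Fin 3 → ℂ → Module.End ℂ V} {lam : ℂ → ℂ}

/-- The counterpart of `apply_raise` for `T₁₃(w)`. The factor `f(w,z)` on the left is the one in the
exchange of `T₁₂(z)` with `T₁₃(w)`. -/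
theorem apply_first_raise (hT : RTT c T) (hc : c ≠ 0) {u : Finset ℂ} {z w : ℂ} (hwz : w ≠ z)
    (Φ : Finset ℂ → V) {v : Finset ℂ} (hz : z ∉ v) (hw : w ∉ v) :
    f c w z • T 0 2 w (raise c lam (T 0 1) (T 0 2) u z z Φ v) =
      T 0 1 z (T 0 2 w (Φ v)) +
      ∑ i ∈ v, (rowWeight c lam u v i * g c i z * f c w i) • T 0 2 z (T 0 2 w (Φ (v.erase i))) +
      g c w z • T 0 2 z (raise c lam (T 0 1) (T 0 2) u w w Φ v) := by
  have hB := hT.rowExchange_first hc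
  have hsum : ∑ i ∈ v, (rowWeight c lam u v i * g c i z * f c w i) •
      T 0 2 z (T 0 2 w (Φ (v.erase i))) =
      f c w z • T 0 2 z (T 0 2 w (removeOne c lam u z Φ v)) -
        g c w z • T 0 2 z (T 0 2 w (removeOne c lam u w Φ v)) := by
    simp only [removeOne, map_sum, map_smul, Finset.smul_sum, ← Finset.sum_sub_distrib, smul_smul,
      ← sub_smul]
    refine Finset.sum_congr rfl fun i hi => ?_
    have hiz : i ≠ z := fun h => hz (h ▸ hi)
    have hiw : i ≠ w := fun h => hw (h ▸ hi)
    congr 1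
    linear_combination rowWeight c lam u v i * g_mul_f_shift c hiw hiz hwz
  have hraise : ∀ x, raise c lam (T 0 1) (T 0 2) u x x Φ v =
      T 0 1 x (Φ v) + T 0 2 x (removeOne c lam u x Φ v) := by
    intro x
    simp only [raise, removeOne, map_sum, map_smul]
  rw [hsum, hraise, hraise, hB.exchange z w hwz.symm, map_add, map_add, hB.comm₃ w z,
    g_swap c w z]
  module

/-- Both sides are expanded by the first recursion in some `z ∈ u`. The summand of `D (insert z u)
(insert w v)` that removes `w` matches the diagonal term of `middle_action` at `w`; the diagonal
term at `z` becomes the summand `j = z`. -/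
theorem IsNested.insert_right (hT : RTT c T) (hc : c ≠ 0) {D : Finset ℂ → Finset ℂ → V}
    (hD : IsNested c lam (T 0 1) (T 0 2) D)
    (hbase : ∀ w v, w ∉ v →
      raise c lam (T 1 1) (T 1 2) ∅ w w (D ∅) v = (lam w * ∏ i ∈ v, f c i w) • D ∅ v)
    (hempty : ∀ w v, w ∉ v → D ∅ (insert w v) = T 1 2 w (D ∅ v))
    (u : Finset ℂ) : ∀ (v : Finset ℂ) (w : ℂ), Disjoint u v → w ∉ u → w ∉ v →
      T 1 2 w (D u v) = D u (insert w v) -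
        ∑ j ∈ u, (g c w j * colWeight c lam u v j) • T 0 2 w (D (u.erase j) v) := by
  induction u using Finset.induction_on with
  | empty =>
    intro v w _ _ hw
    simp [hempty w v hw]
  | insert z u hzu ih =>
    intro v w huv hw hwv
    have hwz : w ≠ z := fun h => hw (h ▸ Finset.mem_insert_self _ _)
    have hwu : w ∉ u := fun h => hw (Finset.mem_insert_of_mem h)
    have huv' : Disjoint u v := huv.mono_left (Finset.subset_insert _ _)
    have hzv : z ∉ v := Finset.disjoint_left.mp huv (Finset.mem_insert_self _ _)
    have hmid := middle_action hT hD hbase u v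
    have hj : ∀ j ∈ u, (g c w j * colWeight c lam (insert z u) v j) •
          T 0 2 w (D ((insert z u).erase j) v) =
        (g c w j * colWeight c lam u v j) • T 0 1 z (T 0 2 w (D (u.erase j) v)) +
        ∑ i ∈ v, (rowWeight c lam u v i * g c i z * f c w i) •
          (g c w j * colWeight c lam u (v.erase i) j) •
            T 0 2 z (T 0 2 w (D (u.erase j) (v.erase i))) +
        (g c w z * (g c w j * colWeight c lam u v j)) •
          T 0 2 z (D (insert w (u.erase j)) v) -
        (g c w z * (g c z j * colWeight c lam u v j)) •
          T 0 2 w (D (insert z (u.erase j)) v) := fun j hj => by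
      have hzj : z ≠ j := fun h => hzu (h ▸ hj)
      have hwj : w ≠ j := fun h => hwu (h ▸ hj)
      have hzu' : z ∉ u.erase j := fun h => hzu (Finset.mem_of_mem_erase h)
      have hwu' : w ∉ u.erase j := fun h => hwu (Finset.mem_of_mem_erase h)
      have hdis : Disjoint (u.erase j) v := huv'.mono_left (Finset.erase_subset j u)
      have hex := apply_first_raise (lam := lam) hT hc hwz (u := u.erase j) (D (u.erase j)) hzv hwv
      rw [← hD z _ v hzu' (Finset.disjoint_insert_left.mpr ⟨hzv, hdis⟩),
        ← hD w _ v hwu' (Finset.disjoint_insert_left.mpr ⟨hwv, hdis⟩)] at hex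
      have hsum : ∑ i ∈ v, (rowWeight c lam u v i * g c i z * f c w i) •
          (g c w j * colWeight c lam u (v.erase i) j) •
            T 0 2 z (T 0 2 w (D (u.erase j) (v.erase i))) =
          (g c w j * colWeight c lam u v j) •
            ∑ i ∈ v, (rowWeight c lam (u.erase j) v i * g c i z * f c w i) •
              T 0 2 z (T 0 2 w (D (u.erase j) (v.erase i))) := by
        rw [Finset.smul_sum]
        refine Finset.sum_congr rfl fun i hi => ?_
        rw [smul_smul, smul_smul, rowWeight_erase_left c lam hj,
          colWeight_erase_right c lam hi u j]
        congr 1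
        ring
      rw [hsum, Finset.erase_insert_of_ne hzj, colWeight_insert_left c lam hzu hj]
      have hg := g_mul_f_exchange c hwz hwj hzj
      calc _ = (g c w j * colWeight c lam u v j) •
            (f c w z • T 0 2 w (D (insert z (u.erase j)) v)) -
            (g c w z * (g c z j * colWeight c lam u v j)) •
              T 0 2 w (D (insert z (u.erase j)) v) := by
            rw [smul_smul, ← sub_smul]
            congr 1
            linear_combination colWeight c lam u v j * hg
        _ = _ := by
            rw [hex]
            module
    have hright : D (insert z u) (insert w v) = T 0 1 z (D u (insert w v)) +
        ((g c w z * (lam w * (∏ i ∈ v, f c i w) * ∏ j ∈ u, f c w j)) • T 0 2 z (D u v) +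
        ∑ i ∈ v, (rowWeight c lam u v i * g c i z * f c w i) •
          T 0 2 z (D u (insert w (v.erase i)))) := by
      rw [hD z u _ hzu (Finset.disjoint_insert_right.mpr ⟨hw, huv⟩), raise,
        Finset.sum_insert hwv, Finset.erase_insert hwv, rowWeight_insert_self c lam hwv]
      congr 2
      · congr 1
        ring
      · refine Finset.sum_congr rfl fun i hi => ?_
        have hwi : w ≠ i := fun h => hwv (h ▸ hi)
        rw [Finset.erase_insert_of_ne hwi, rowWeight_insert_right c lam hwv hi]
        congr 1
        ring
    rw [hD z u v hzu huv, apply_raise lam hT hwz _ hzv hwv, hmid w huv' hwu hwv,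
      hmid z huv' hzu hzv, ih v w huv' hwu hwv, hright, Finset.sum_insert hzu,
      Finset.erase_insert hzu, colWeight_insert_self c lam hzu, Finset.sum_congr rfl hj,
      Finset.sum_congr (s₁ := v) rfl fun i _ => by rw [ih (v.erase i) w
        (huv'.mono_right (Finset.erase_subset i v)) hwu fun h => hwv (Finset.mem_of_mem_erase h)]]
    simp only [map_sub, map_sum, map_smul, smul_sub, Finset.smul_sum,
      Finset.sum_add_distrib, Finset.sum_sub_distrib, smul_smul]
    rw [Finset.sum_comm (s := v) (t := u)]
    abel

end DualRecursion

/-! ### The action of the transfer matrix on a nested family. -/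

section TransferAction

variable {V : Type*} [AddCommGroup V] [Module ℂ V] {c : ℂ}
  {T : Fin 3 → Fin 3 → ℂ → Module.End ℂ V}

/-- In an exchange term the operators sit at `w` while the coefficients keep the old parameter `x`.
Comparison with the recursion at `w` leaves a value of `D` and a correction in which some `v_i` is
removed too. -/
theorem IsNested.raise_shift {lam : ℂ → ℂ} {B₂ B₃ : ℂ → Module.End ℂ V}
    {D : Finset ℂ → Finset ℂ → V} (hD : IsNested c lam B₂ B₃ D) {u v : Finset ℂ} {w : ℂ}
    (hwu : w ∉ u) (hwv : w ∉ v) (huv : Disjoint u v) (x : ℂ) :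
    raise c lam B₂ B₃ u x w (D u) v = D (insert w u) v +
      ∑ i ∈ v, (rowWeight c lam u v i * (g c i x - g c i w)) • B₃ w (D u (v.erase i)) := by
  rw [hD w u v hwu (Finset.disjoint_insert_left.mpr ⟨hwv, huv⟩)]
  simp only [raise, mul_sub, sub_smul, Finset.sum_sub_distrib]
  abel

variable {lam : Fin 3 → ℂ → ℂ} {D : Finset ℂ → Finset ℂ → V}

/-- A `gl₂` problem: `diagonal_action` applies with zero in the role of `T₁₃`, and its unwanted
terms cancel against the `T₂₃` sum because `g` is antisymmetric. -/
theorem middle_action_empty (hT : RTT c T) (hc : c ≠ 0)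
    (hvac : IsHighestWeight T lam (D ∅ ∅))
    (hempty : ∀ w v, w ∉ v → D ∅ (insert w v) = T 1 2 w (D ∅ v)) (w : ℂ) (v : Finset ℂ)
    (hw : w ∉ v) :
    raise c (lam 1) (T 1 1) (T 1 2) ∅ w w (D ∅) v = (lam 1 w * ∏ i ∈ v, f c i w) • D ∅ v := by
  have hB : RowExchange c (T 1 2) (0 : ℂ → Module.End ℂ V) :=
    ⟨fun p q φ => hT.commute_same hc 1 2 p q φ, fun _ _ _ => rfl, fun p q _ φ => by simp⟩
  have hN : IsNested c (lam 1) (T 1 2) (0 : ℂ → Module.End ℂ V) (fun u _ => D ∅ u) := by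
    intro z u v hz _
    simp [raise, hempty z u hz]
  have h := diagonal_action c (lam 1) hB hN (T 1 1) (lam 1) (fun w z hwz φ => hT.diag_apply_row 1 2 hwz φ)
    (fun w z _ φ => by simp) (fun w _ _ => hvac.2 1 w) v ∅ w (Finset.disjoint_empty_right v) hw
    (Finset.notMem_empty w)
  rw [raise, h, add_assoc, ← Finset.sum_add_distrib, Finset.sum_eq_zero, add_zero]
  intro i _
  simp only [raise, rowWeight, Finset.prod_empty, mul_one, Finset.sum_empty, add_zero]
  rw [g_swap c w i]
  module

/-- `T₁₁` past `T₂₃` creates terms ending in `T₂₁`, and `T₂₁` past `T₂₃` only such terms, so both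
claims are proved in one induction. -/
theorem lowering_empty_right (hT : RTT c T) (hvac : IsHighestWeight T lam (D ∅ ∅))
    (hempty : ∀ w v, w ∉ v → D ∅ (insert w v) = T 1 2 w (D ∅ v)) (v : Finset ℂ) :
    (∀ w, w ∉ v → T 1 0 w (D ∅ v) = 0) ∧ ∀ w, w ∉ v → T 0 0 w (D ∅ v) = lam 0 w • D ∅ v := by
  induction v using Finset.induction_on with
  | empty => exact ⟨fun w _ => hvac.1 1 0 (by decide) w, fun w _ => hvac.2 0 w⟩
  | insert z v hz ih =>
    rw [hempty z v hz]
    constructor <;> intro w hw <;>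
      obtain ⟨hwz, hwv⟩ := not_or.mp (Finset.mem_insert.not.mp hw)
    · have h := hT.apply_apply (Ne.symm hwz) 1 2 1 0 (D ∅ v)
      rw [ih.1 w hwv, ih.1 z hz] at h
      simpa using h.symm
    · have h := hT.apply_apply (Ne.symm hwz) 1 2 0 0 (D ∅ v)
      rw [ih.1 w hwv, ih.1 z hz, ih.2 w hwv] at h
      simpa using h.symm

/-- The mirror image of `lowering_empty_right`: here `T₃₃` past `T₁₂` creates terms ending in `T₃₂`.
-/
theorem lowering_empty_left (hT : RTT c T) (hvac : IsHighestWeight T lam (D ∅ ∅))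
    (hD : IsNested c (lam 1) (T 0 1) (T 0 2) D) (u : Finset ℂ) :
    (∀ w, w ∉ u → T 2 1 w (D u ∅) = 0) ∧ ∀ w, w ∉ u → T 2 2 w (D u ∅) = lam 2 w • D u ∅ := by
  induction u using Finset.induction_on with
  | empty => exact ⟨fun w _ => hvac.1 2 1 (by decide) w, fun w _ => hvac.2 2 w⟩
  | insert z u hz ih =>
    have hz' : D (insert z u) ∅ = T 0 1 z (D u ∅) := by
      simp [hD z u ∅ hz (Finset.disjoint_empty_right _), raise]
    rw [hz']
    constructor <;> intro w hw <;>
      obtain ⟨hwz, hwu⟩ := not_or.mp (Finset.mem_insert.not.mp hw)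
    · have h := hT.apply_apply hwz 2 1 0 1 (D u ∅)
      rw [ih.1 w hwu, ih.1 z hz] at h
      simpa using h
    · have h := hT.apply_apply hwz 2 2 0 1 (D u ∅)
      rw [ih.1 w hwu, ih.1 z hz, ih.2 w hwu] at h
      simpa using h

/-- Here `X`, `Y` are the off-shell factors of the Bethe equations cleared of denominators; that is
why neither `λ₂(w) ≠ 0` nor any shifted condition on `w` is required. -/
theorem transfer_action (hT : RTT c T) (hc : c ≠ 0) (hvac : IsHighestWeight T lam (D ∅ ∅))
    (hD : IsNested c (lam 1) (T 0 1) (T 0 2) D)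
    (hempty : ∀ w v, w ∉ v → D ∅ (insert w v) = T 1 2 w (D ∅ v)) {u v : Finset ℂ}
    (huv : Disjoint u v) {w : ℂ} (hwu : w ∉ u) (hwv : w ∉ v) {X Y : ℂ → ℂ}
    (hX : ∀ j, X j = lam 0 j * (∏ k ∈ u.erase j, f c k j) - colWeight c (lam 1) u v j)
    (hY : ∀ i, Y i = lam 2 i * (∏ k ∈ v.erase i, f c i k) - rowWeight c (lam 1) u v i) :
    transferMatrix T w (D u v) =
      (lam 0 w * (∏ j ∈ u, f c j w) + lam 1 w * (∏ j ∈ u, f c w j) * (∏ i ∈ v, f c i w) +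
        lam 2 w * ∏ i ∈ v, f c w i) • D u v +
      ∑ j ∈ u, (g c w j * X j) • D (insert w (u.erase j)) v +
      ∑ i ∈ v, (g c i w * Y i) • D u (insert w (v.erase i)) +
      ∑ i ∈ v, ∑ j ∈ u, (g c i j * (g c w i * rowWeight c (lam 1) (u.erase j) v i * X j +
        g c j w * colWeight c (lam 1) u (v.erase i) j * Y i)) •
          T 0 2 w (D (u.erase j) (v.erase i)) := by
  have hbase := middle_action_empty hT hc hvac hempty
  have hright := hD.insert_right hT hc hbase hempty
  -- The dual recursion read as the original one, with the two sets interchanged and `c` negated.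
  have hD' : IsNested (-c) (lam 1) (T 1 2) (T 0 2) (fun u v => D v u) := by
    intro z u v hz hdis
    obtain ⟨hzv, huv⟩ := Finset.disjoint_insert_left.mp hdis
    simp only [raise, rowWeight_neg, g_neg, hright v u z huv.symm hzv hz]
    rw [Finset.sum_congr rfl fun j _ => by rw [mul_comm (g c z j)]]
    abel
  have h0 := diagonal_action c (lam 1) (hT.rowExchange_first hc) hD (T 0 0) (lam 0)
    (fun w z hwz φ => hT.diag_apply_row 0 1 hwz φ)
    (fun w z hwz φ => hT.diag_apply_row 0 2 hwz φ)
    (fun w v hw => (lowering_empty_right hT hvac hempty v).2 w hw) u v w huv hwu hwv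
  have h2 := diagonal_action (-c) (lam 1) (hT.rowExchange_last hc) hD' (T 2 2) (lam 2)
    (fun w z hwz φ => hT.diag_apply_col 1 2 hwz φ)
    (fun w z hwz φ => hT.diag_apply_col 0 2 hwz φ)
    (fun w u hw => (lowering_empty_left hT hvac hD u).2 w hw) v u w huv.symm hwv hwu
  have h1 := middle_action hT hD hbase u v w huv hwu hwv
  rw [raise] at h1
  have h1' := eq_sub_of_add_eq h1
  simp only [f_neg, g_neg] at h2
  have hne : ∀ i ∈ v, ∀ j ∈ u, i ≠ w ∧ w ≠ j ∧ i ≠ j := fun i hi j hj =>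
    ⟨fun h => hwv (h ▸ hi), fun h => hwu (h ▸ hj), fun h => Finset.disjoint_left.mp huv hj (h ▸ hi)⟩
  have hdis : ∀ i, Disjoint u (v.erase i) := fun i => huv.mono_right (Finset.erase_subset i v)
  rw [Finset.sum_congr rfl fun j _ => by rw [hD.raise_shift
    (fun h => hwu (Finset.mem_of_mem_erase h)) hwv (huv.mono_left (Finset.erase_subset j u))]] at h0
  rw [Finset.sum_congr rfl fun i _ => by rw [hD'.raise_shift
    (fun h => hwv (Finset.mem_of_mem_erase h)) hwu (hdis i).symm]] at h2
  rw [Finset.sum_congr (s₁ := v) rfl fun i _ => by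
    rw [hright u (v.erase i) w (hdis i) hwu fun h => hwv (Finset.mem_of_mem_erase h)]] at h1'
  simp only [rowWeight_neg, g_neg] at h2
  -- The terms with both `u_j` and `v_i` removed have three sources: the shift for `T₁₁`, the `T₂₃`
  -- terms that accompany `T₂₂`, and the shift for `T₃₃`. Below, `e1`, `e2`, `e3` match the parts
  -- with `λ₁(u_j)`, with `λ₃(v_i)`, and with `λ₂` alone.
  have hij : ∑ i ∈ v, ∑ j ∈ u, (g c i j * (g c w i * rowWeight c (lam 1) (u.erase j) v i * X j +
        g c j w * colWeight c (lam 1) u (v.erase i) j * Y i)) •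
          T 0 2 w (D (u.erase j) (v.erase i)) =
      ∑ j ∈ u, ∑ i ∈ v, (g c w j * (lam 0 j * ∏ k ∈ u.erase j, f c k j) *
        (rowWeight c (lam 1) (u.erase j) v i * (g c i j - g c i w))) •
          T 0 2 w (D (u.erase j) (v.erase i)) +
      ∑ i ∈ v, ∑ j ∈ u, (rowWeight c (lam 1) u v i * g c i w *
        (g c w j * colWeight c (lam 1) u (v.erase i) j)) •
          T 0 2 w (D (u.erase j) (v.erase i)) +
      ∑ i ∈ v, ∑ j ∈ u, (g c i w * (lam 2 i * ∏ k ∈ v.erase i, f c i k) *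
        (colWeight c (lam 1) u (v.erase i) j * (g c i j - g c w j))) •
          T 0 2 w (D (u.erase j) (v.erase i)) := by
    rw [Finset.sum_comm (s := u) (t := v)]
    simp only [← Finset.sum_add_distrib, ← add_smul]
    refine Finset.sum_congr rfl fun i hi => Finset.sum_congr rfl fun j hj => ?_
    obtain ⟨hiw, hwj, hij⟩ := hne i hi j hj
    congr 1
    have e1 : g c w j * (g c i j - g c i w) = g c i j * g c w i := by
      have h1 := sub_ne_zero.mpr hiw
      have h2 := sub_ne_zero.mpr hwj
      have h3 := sub_ne_zero.mpr hij
      have h4 := sub_ne_zero.mpr hiw.symm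
      simp only [g]
      field_simp
      ring
    have e2 : g c i w * (g c i j - g c w j) = g c i j * g c j w := by
      have h1 := sub_ne_zero.mpr hiw
      have h2 := sub_ne_zero.mpr hwj
      have h3 := sub_ne_zero.mpr hij
      have h4 := sub_ne_zero.mpr hwj.symm
      simp only [g]
      field_simp
      ring
    have e3 : g c i j * (g c w i + g c j w) = -(g c i w * g c w j) := by
      have h1 := sub_ne_zero.mpr hiw
      have h2 := sub_ne_zero.mpr hwj
      have h3 := sub_ne_zero.mpr hij
      have h4 := sub_ne_zero.mpr hiw.symm
      have h5 := sub_ne_zero.mpr hwj.symm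
      simp only [g]
      field_simp
      ring
    rw [hX, hY, rowWeight_erase_left c _ hj, colWeight_erase_right c _ hi u j]
    linear_combination (-(lam 0 j * ∏ k ∈ u.erase j, f c k j) *
        rowWeight c (lam 1) (u.erase j) v i) * e1 -
      ((lam 2 i * ∏ k ∈ v.erase i, f c i k) * colWeight c (lam 1) u (v.erase i) j) * e2 -
      f c i j * rowWeight c (lam 1) (u.erase j) v i * colWeight c (lam 1) u (v.erase i) j * e3
  have hXs : ∑ j ∈ u, (g c w j * X j) • D (insert w (u.erase j)) v =
      ∑ j ∈ u, (g c w j * (lam 0 j * ∏ k ∈ u.erase j, f c k j)) • D (insert w (u.erase j)) v -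
      ∑ j ∈ u, (g c w j * colWeight c (lam 1) u v j) • D (insert w (u.erase j)) v := by
    simp only [hX, mul_sub, sub_smul, Finset.sum_sub_distrib]
  have hYs : ∑ i ∈ v, (g c i w * Y i) • D u (insert w (v.erase i)) =
      ∑ i ∈ v, (g c i w * (lam 2 i * ∏ k ∈ v.erase i, f c i k)) • D u (insert w (v.erase i)) -
      ∑ i ∈ v, (rowWeight c (lam 1) u v i * g c i w) • D u (insert w (v.erase i)) := by
    simp only [hY, mul_sub, sub_smul, Finset.sum_sub_distrib, mul_comm (g c _ w) (rowWeight _ _ _ _ _)]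
  rw [transferMatrix, LinearMap.add_apply, LinearMap.add_apply, h0, h1', h2, hij, hXs, hYs,
    mul_right_comm (lam 1 w)]
  simp only [smul_add, smul_sub, Finset.smul_sum, smul_smul, Finset.sum_add_distrib,
    Finset.sum_sub_distrib, add_smul]
  abel

end TransferAction

/-! ### The Izergin--Korepin determinant -/

section Recursion

variable (c : ℂ)

/-- Exactly `i` of the other indices lie below `i`, so the cofactor sign and the sign of the pairs
above `i` give a product independent of `i`. -/
theorem prod_ite_succAbove_sign {k : ℕ} (i : Fin (k + 1)) :
    (-1 : ℂ) ^ (i : ℕ) * ∏ l : Fin k, (if i < i.succAbove l then (-1 : ℂ) else 1) = (-1) ^ k := by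
  have h : ∏ l : Fin k, (if i.succAbove l < i then (-1 : ℂ) else 1) = (-1) ^ (i : ℕ) := by
    rw [Finset.prod_ite, Finset.prod_const, Finset.prod_const_one, mul_one]
    congr 1
    simp only [Fin.succAbove_lt_iff_castSucc_lt]
    simp only [Fin.lt_def, Fin.val_castSucc]
    rw [Fin.card_filter_val_lt, min_eq_right (Nat.lt_succ_iff.mp i.isLt)]
  rw [← h, ← Finset.prod_mul_distrib]
  have : ∀ l : Fin k, (if i.succAbove l < i then (-1 : ℂ) else 1) *
      (if i < i.succAbove l then (-1 : ℂ) else 1) = -1 := by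
    intro l
    rcases lt_or_gt_of_ne (Fin.succAbove_ne i l) with h | h
    · simp [h, h.not_gt]
    · simp [h, h.not_gt]
  simp [this]

theorem prod_pairs_succAbove {k : ℕ} (i : Fin (k + 1)) (x : Fin (k + 1) → ℂ) :
    (-1 : ℂ) ^ (i : ℕ) *
      ∏ m, ∏ l ∈ Finset.univ.filter (fun l => l < m), g c (x l) (x m) =
    (-1) ^ k * (∏ l, g c (x (i.succAbove l)) (x i)) *
      ∏ m, ∏ l ∈ Finset.univ.filter (fun l => l < m),
        g c (x (i.succAbove l)) (x (i.succAbove m)) := by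
  rw [← prod_ite_succAbove_sign i]
  simp only [Finset.prod_filter]
  rw [Fin.prod_univ_succAbove _ i]
  simp only [Fin.prod_univ_succAbove _ i, lt_irrefl, if_false, one_mul,
    (Fin.strictMono_succAbove i).lt_iff_lt, Finset.prod_mul_distrib]
  have h : (∏ l : Fin k, if i.succAbove l < i then g c (x (i.succAbove l)) (x i) else 1) *
      (∏ l : Fin k, if i < i.succAbove l then g c (x i) (x (i.succAbove l)) else 1) =
      (∏ l : Fin k, if i < i.succAbove l then (-1 : ℂ) else 1) *
        ∏ l : Fin k, g c (x (i.succAbove l)) (x i) := by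
    simp only [← Finset.prod_mul_distrib]
    refine Finset.prod_congr rfl fun l _ => ?_
    rcases lt_or_gt_of_ne (Fin.succAbove_ne i l) with h | h
    · simp [h, h.not_gt]
    · simp [h, h.not_gt, g_swap c (x (i.succAbove l)) (x i)]
  linear_combination ((-1 : ℂ) ^ (i : ℕ) * ∏ m : Fin k, ∏ l : Fin k,
    if l < m then g c (x (i.succAbove l)) (x (i.succAbove m)) else 1) * h

/-- Orienting all `x`-pairs towards `x i` absorbs the cofactor sign; the remaining `(-1)^k` cancels
against the one from turning round the pairs of `y 0`. -/
theorem ikPrefactor_succAbove {k : ℕ} (i : Fin (k + 1)) (x y : Fin (k + 1) → ℂ) :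
    (-1 : ℂ) ^ (i : ℕ) * ikPrefactor c x y =
      (∏ l, g c (x (i.succAbove l)) (x i)) * (∏ m : Fin k, g c (y 0) (y m.succ)) *
        ikPrefactor c (fun l => x (i.succAbove l)) (fun m => y m.succ) := by
  have h1 := prod_pairs_succAbove c i x
  have h2 := prod_pairs_succAbove (-c) 0 y
  have h3 : ∏ m : Fin k, g c (y 0) (y m.succ) = (-1) ^ k * ∏ m : Fin k, g c (y m.succ) (y 0) := by
    simp [g_swap c _ (y 0), Finset.prod_neg]
  simp only [g_neg, Fin.succAbove_zero, Fin.val_zero, pow_zero, one_mul] at h2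
  simp only [ikPrefactor, Finset.prod_mul_distrib]
  rw [← mul_assoc, h1, h2]
  ring_nf
  simp

/-- Interpolate `s ↦ ∏_{l ≠ i} (x_l - s + c)`, of degree at most `k`, at the `k + 1` nodes `y_q` and
evaluate at `x_i`. Since `h(x_i,y_q)⁻¹` cancels the `i`-th factor of `∏_l (x_l - y_q + c)`, the
weights do not depend on the row: this is a linear combination of columns. -/
theorem lagrange_column {k : ℕ} (hc : c ≠ 0) (x y : Fin (k + 1) → ℂ)
    (hy : Function.Injective y) (hsh : ∀ i j, x i - y j + c ≠ 0) (i : Fin (k + 1)) :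
    ∏ l : Fin k, (x (i.succAbove l) - x i + c) =
      ∑ q, ((∏ l, (x l - y q + c)) / c * ∏ p ∈ Finset.univ.erase q, c / (y q - y p)) *
        ((h c (x i) (y q))⁻¹ * ∏ l ∈ Finset.univ.erase q, (x i - y l) / c) := by
  open Polynomial in
  let P : ℂ[X] := ∏ l : Fin k, (C (x (i.succAbove l) + c) - X)
  have hP : ∀ s, P.eval s = ∏ l : Fin k, (x (i.succAbove l) - s + c) := by
    intro s
    simp only [P, Polynomial.eval_prod, Polynomial.eval_sub, Polynomial.eval_C, Polynomial.eval_X]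
    exact Finset.prod_congr rfl fun l _ => by ring
  have hdeg : P.degree < (Finset.univ : Finset (Fin (k + 1))).card := by
    rw [Finset.card_univ, Fintype.card_fin]
    refine lt_of_le_of_lt (Polynomial.degree_prod_le _ _) ?_
    refine lt_of_le_of_lt (Finset.sum_le_card_nsmul _ _ 1 fun l _ => ?_) ?_
    · rw [← neg_sub, Polynomial.degree_neg]
      exact (Polynomial.degree_X_sub_C _).le
    · rw [Finset.card_univ, Fintype.card_fin, nsmul_one]
      exact_mod_cast Nat.lt_succ_self k
  have heq := congrArg (Polynomial.eval (x i)) (Lagrange.eq_interpolate (hy.injOn) hdeg)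
  rw [Lagrange.interpolate_apply, Polynomial.eval_finsetSum, hP] at heq
  rw [heq]
  refine Finset.sum_congr rfl fun q _ => ?_
  have h1 := hsh i q
  rw [Polynomial.eval_mul, Polynomial.eval_C, hP, Lagrange.basis, Polynomial.eval_prod,
    Fin.prod_univ_succAbove _ i, h]
  have h2 : ∀ p ∈ Finset.univ.erase q,
      Polynomial.eval (x i) (Lagrange.basisDivisor (y q) (y p)) =
        c / (y q - y p) * ((x i - y p) / c) := fun p _ => by
    simp only [Lagrange.basisDivisor, Polynomial.eval_mul, Polynomial.eval_C, Polynomial.eval_sub,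
      Polynomial.eval_X]
    field_simp
  rw [Finset.prod_congr rfl h2, Finset.prod_mul_distrib]
  field_simp

/-- Replacing column `0` by the combination of `lagrange_column` multiplies the determinant by `ρ
0`. In the expansion along that column each minor has the same shape again, apart from a factor
`(x_l - y_0) / c` in each row. -/
theorem reducedIK_recursion {k : ℕ} (hc : c ≠ 0) (x y : Fin (k + 1) → ℂ)
    (hy : Function.Injective y) (hsh : ∀ i j, x i - y j + c ≠ 0) :
    (∏ l, (x l - y 0 + c)) * reducedIK c x y =
      ∑ i, c * (∏ l : Fin k, f c (x (i.succAbove l)) (x i) * (x (i.succAbove l) - y 0)) *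
        reducedIK c (fun l => x (i.succAbove l)) (fun m => y m.succ) := by
  set A : Matrix (Fin (k + 1)) (Fin (k + 1)) ℂ := Matrix.of fun i j =>
    (h c (x i) (y j))⁻¹ * ∏ l ∈ Finset.univ.erase j, (x i - y l) / c with hA
  set ρ : Fin (k + 1) → ℂ := fun q =>
    (∏ l, (x l - y q + c)) / c * ∏ p ∈ Finset.univ.erase q, c / (y q - y p) with hρ
  have hdet := Matrix.det_updateCol_sum A 0 ρ
  have hcol : (fun i => ∑ q, ρ q • A i q) =
      fun i => ∏ l : Fin k, (x (i.succAbove l) - x i + c) := by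
    funext i
    exact (lagrange_column c hc x y hy hsh i).symm
  have hminor : ∀ i : Fin (k + 1), (A.submatrix i.succAbove Fin.succ).det =
      (∏ l : Fin k, (x (i.succAbove l) - y 0) / c) *
        Matrix.det (Matrix.of fun p q : Fin k => (h c (x (i.succAbove p)) (y q.succ))⁻¹ *
          ∏ l ∈ Finset.univ.erase q, (x (i.succAbove p) - y l.succ) / c) := by
    intro i
    rw [← Matrix.det_mul_column]
    congr 1
    ext p q
    simp only [hA, Matrix.submatrix_apply, Matrix.of_apply]
    have : Finset.univ.erase q.succ = insert 0 ((Finset.univ.erase q).map (Fin.succEmb k)) := by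
      ext m
      refine Fin.cases ?_ (fun m => ?_) m
      · simp [(Fin.succ_ne_zero q).symm]
      · simp
    rw [this, Finset.prod_insert (by simp), Finset.prod_map]
    simp only [Fin.coe_succEmb]
    ring
  have hρ0 : ρ 0 = (∏ l, (x l - y 0 + c)) / c * ∏ m : Fin k, g c (y 0) (y m.succ) := by
    simp only [hρ, g]
    congr 1
    rw [Fin.univ_succ, Finset.cons_eq_insert, Finset.erase_insert (by simp), Finset.prod_map]
    rfl
  rw [hcol, Matrix.det_succ_column_zero, smul_eq_mul, hρ0] at hdet
  have hsub : ∀ (i : Fin (k + 1)) (F : Fin (k + 1) → ℂ),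
      (A.updateCol 0 F).submatrix i.succAbove Fin.succ = A.submatrix i.succAbove Fin.succ := by
    intro i F
    ext p q
    simp
  simp only [hsub, hminor, Matrix.updateCol_self] at hdet
  have hW : ∏ m : Fin k, g c (y 0) (y m.succ) ≠ 0 :=
    Finset.prod_ne_zero_iff.mpr fun m _ =>
      div_ne_zero hc (sub_ne_zero.mpr fun he => (Fin.succ_ne_zero m) (hy he).symm)
  refine mul_left_cancel₀ hW ?_
  have hpre : ∀ i : Fin (k + 1), ikPrefactor c x y * ((-1 : ℂ) ^ (i : ℕ) *
      ∏ l : Fin k, (x (i.succAbove l) - x i + c)) *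
      (∏ l : Fin k, (x (i.succAbove l) - y 0) / c) =
      (∏ m : Fin k, g c (y 0) (y m.succ)) *
        (∏ l : Fin k, f c (x (i.succAbove l)) (x i) * (x (i.succAbove l) - y 0)) *
        ikPrefactor c (fun l => x (i.succAbove l)) (fun m => y m.succ) := by
    intro i
    have hfg : ∏ l : Fin k, f c (x (i.succAbove l)) (x i) * (x (i.succAbove l) - y 0) =
        (∏ l : Fin k, g c (x (i.succAbove l)) (x i)) *
          (∏ l : Fin k, (x (i.succAbove l) - x i + c)) *
          ∏ l : Fin k, (x (i.succAbove l) - y 0) / c := by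
      simp only [← Finset.prod_mul_distrib]
      refine Finset.prod_congr rfl fun l _ => ?_
      simp only [f, g]
      field_simp
    rw [hfg]
    linear_combination (∏ l : Fin k, (x (i.succAbove l) - x i + c)) *
      (∏ l : Fin k, (x (i.succAbove l) - y 0) / c) * ikPrefactor_succAbove c i x y
  calc _ = c * (ikPrefactor c x y * ((∏ l, (x l - y 0 + c)) / c *
        (∏ m : Fin k, g c (y 0) (y m.succ)) * A.det)) := by
        rw [reducedIK, ← hA]
        field_simp
    _ = _ := by
        rw [← hdet, Finset.mul_sum, Finset.mul_sum, Finset.mul_sum]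
        refine Finset.sum_congr rfl fun i _ => ?_
        rw [reducedIK]
        linear_combination c * (Matrix.det (Matrix.of fun p q : Fin k =>
          (h c (x (i.succAbove p)) (y q.succ))⁻¹ *
          ∏ l ∈ Finset.univ.erase q, (x (i.succAbove p) - y l.succ) / c)) * hpre i

end Recursion

/-! ### The determinant as a function of two finite sets. -/

section Numerator

variable (c : ℂ)

/-- The numerator of the Izergin--Korepin determinant, by recursion in its second set. -/
noncomputable def ikNumList : List ℂ → Finset ℂ → ℂ
  | [], J => if J = ∅ then 1 else 0
  | z :: I, J => ∑ x ∈ J, c * (∏ y ∈ J.erase x, f c y x * (y - z)) *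
      (I.map fun y => x - y + c).prod * ikNumList I (J.erase x)

/-- Needed for the recursion to define a function of a set. Two steps give a sum over ordered pairs
of removed elements, and the difference of the two orders is antisymmetric in the pair. -/
theorem ikNumList_swap (z w : ℂ) (I : List ℂ) (J : Finset ℂ) :
    ikNumList c (z :: w :: I) J = ikNumList c (w :: z :: I) J := by
  rw [← sub_eq_zero]
  simp only [ikNumList, Finset.mul_sum, ← Finset.sum_sub_distrib, List.map_cons, List.prod_cons]
  refine sum_erase_eq_zero_of_antisymm J _ fun i hi k hk hik => ?_
  have hki : k ∈ J.erase i := Finset.mem_erase.mpr ⟨hik.symm, hk⟩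
  have hik' : i ∈ J.erase k := Finset.mem_erase.mpr ⟨hik, hi⟩
  have e1 : ∀ s, ∏ y ∈ J.erase i, f c y i * (y - s) = f c k i * (k - s) *
      ∏ y ∈ (J.erase i).erase k, f c y i * (y - s) := fun s =>
    (Finset.mul_prod_erase _ (fun y => f c y i * (y - s)) hki).symm
  have e2 : ∀ s, ∏ y ∈ J.erase k, f c y k * (y - s) = f c i k * (i - s) *
      ∏ y ∈ (J.erase i).erase k, f c y k * (y - s) := fun s => by
    rw [Finset.erase_right_comm]
    exact (Finset.mul_prod_erase _ (fun y => f c y k * (y - s)) hik').symm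
  simp only [e1, e2]
  rw [Finset.erase_right_comm (a := k) (b := i)]
  simp only [Finset.prod_mul_distrib]
  have h1 := sub_ne_zero.mpr hik
  have h2 := sub_ne_zero.mpr hik.symm
  have hf : f c k i * ((k - z) * (i - w + c) - (k - w) * (i - z + c)) +
      f c i k * ((i - z) * (k - w + c) - (i - w) * (k - z + c)) = 0 := by
    simp only [f]
    field_simp
    ring
  linear_combination c ^ 2 * (∏ y ∈ (J.erase i).erase k, f c y i) *
    (∏ y ∈ (J.erase i).erase k, f c y k) * (∏ y ∈ (J.erase i).erase k, (y - z)) *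
    (∏ y ∈ (J.erase i).erase k, (y - w)) * (I.map fun y => i - y + c).prod *
    (I.map fun y => k - y + c).prod * ikNumList c I ((J.erase i).erase k) * hf

theorem ikNumList_perm {I I' : List ℂ} (h : I.Perm I') (J : Finset ℂ) :
    ikNumList c I J = ikNumList c I' J := by
  induction h generalizing J with
  | nil => rfl
  | cons z h ih => simp only [ikNumList, ih, (h.map _).prod_eq]
  | swap z w I => exact ikNumList_swap c w z I J
  | trans _ _ ih ih' => rw [ih, ih']

/-- The numerator `K(x̄_J|ȳ_I) ∏ (x - y)` of the Izergin--Korepin determinant of two finite sets. -/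
noncomputable def ikNum (J I : Finset ℂ) : ℂ := ikNumList c I.toList J

theorem ikNum_empty (J : Finset ℂ) : ikNum c J ∅ = if J = ∅ then 1 else 0 := by
  simp [ikNum, ikNumList]

theorem ikNum_insert {z : ℂ} {I : Finset ℂ} (hz : z ∉ I) (J : Finset ℂ) :
    ikNum c J (insert z I) = ∑ x ∈ J, c * (∏ y ∈ J.erase x, f c y x * (y - z)) *
      (∏ y ∈ I, (x - y + c)) * ikNum c (J.erase x) I := by
  rw [ikNum, ikNumList_perm c (Finset.toList_insert hz), ikNumList]
  simp only [Finset.prod_map_toList, ikNum]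

/-- Allows the sums over partitions to run over all pairs of subsets, without the condition on
cardinalities. -/
theorem ikNum_eq_zero {I J : Finset ℂ} (h : J.card ≠ I.card) : ikNum c J I = 0 := by
  induction I using Finset.induction_on generalizing J with
  | empty =>
    rw [ikNum_empty, if_neg]
    rintro rfl
    exact h rfl
  | insert z I hz ih =>
    rw [ikNum_insert c hz]
    refine Finset.sum_eq_zero fun x hx => ?_
    rw [ih, mul_zero]
    rw [Finset.card_insert_of_notMem hz] at h
    have := Finset.card_erase_add_one hx
    omega

/-- The Izergin--Korepin determinant `K(x̄_J|ȳ_I)` of two finite sets. -/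
noncomputable def ikSet (J I : Finset ℂ) : ℂ := ikNum c J I / ∏ x ∈ J, ∏ y ∈ I, (x - y)

theorem ikSet_insert {z : ℂ} {I J : Finset ℂ} (hz : z ∉ I) (hJ : Disjoint J (insert z I)) :
    ikSet c J (insert z I) = ∑ x ∈ J, (∏ y ∈ J.erase x, f c y x) * (∏ y ∈ I, f c x y) *
      ikSet c (J.erase x) I * g c x z := by
  rw [ikSet, ikNum_insert c hz, Finset.sum_div]
  refine Finset.sum_congr rfl fun x hx => ?_
  have hne : ∀ x ∈ J, ∀ y ∈ insert z I, x - y ≠ 0 := fun x hx y hy =>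
    sub_ne_zero.mpr fun h => Finset.disjoint_left.mp hJ hx (h ▸ hy)
  have h1 : ∏ x ∈ J, ∏ y ∈ insert z I, (x - y) = (x - z) * (∏ y ∈ J.erase x, (y - z)) *
      ((∏ y ∈ I, (x - y)) * ∏ x ∈ J.erase x, ∏ y ∈ I, (x - y)) := by
    simp only [Finset.prod_insert hz, Finset.prod_mul_distrib]
    rw [Finset.mul_prod_erase J (fun y => y - z) hx,
      Finset.mul_prod_erase J (fun x => ∏ y ∈ I, (x - y)) hx]
  have h2 := hne x hx z (Finset.mem_insert_self z I)
  have h3 : ∏ y ∈ J.erase x, (y - z) ≠ 0 := Finset.prod_ne_zero_iff.mpr fun y hy =>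
    hne y (Finset.mem_of_mem_erase hy) z (Finset.mem_insert_self z I)
  have h4 : ∏ y ∈ I, (x - y) ≠ 0 := Finset.prod_ne_zero_iff.mpr fun y hy =>
    hne x hx y (Finset.mem_insert_of_mem hy)
  have h5 : ∏ x ∈ J.erase x, ∏ y ∈ I, (x - y) ≠ 0 := Finset.prod_ne_zero_iff.mpr fun x' hx' =>
    Finset.prod_ne_zero_iff.mpr fun y hy =>
      hne x' (Finset.mem_of_mem_erase hx') y (Finset.mem_insert_of_mem hy)
  have h6 : ∏ y ∈ I, f c x y = (∏ y ∈ I, (x - y + c)) / ∏ y ∈ I, (x - y) := by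
    simp only [f, Finset.prod_div_distrib]
  rw [h1, h6, ikSet, Finset.prod_mul_distrib, g]
  field_simp

/-- The partial fraction expansion in `z`: the left side has simple poles at `x` and at the points
of `W`, and vanishes at infinity. -/
theorem g_mul_prod_f {x z : ℂ} (hxz : x ≠ z) {W : Finset ℂ} (hx : x ∉ W) (hz : z ∉ W) :
    g c x z * ∏ y ∈ W, f c z y = g c x z * (∏ y ∈ W, f c x y) +
      ∑ w ∈ W, g c z w * (∏ y ∈ W.erase w, f c w y) * g c x w := by
  induction W using Finset.induction_on generalizing z with
  | empty => simp
  | insert t W ht ih =>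
    obtain ⟨hxt, hxW⟩ := not_or.mp (Finset.mem_insert.not.mp hx)
    obtain ⟨hzt, hzW⟩ := not_or.mp (Finset.mem_insert.not.mp hz)
    have h1 := ih hxz hxW hzW
    have h2 := ih hxt hxW ht
    have hw : ∀ w ∈ W, g c z w * (∏ y ∈ (insert t W).erase w, f c w y) * g c x w =
        f c z t * (g c z w * (∏ y ∈ W.erase w, f c w y) * g c x w) -
          g c z t * (g c t w * (∏ y ∈ W.erase w, f c w y) * g c x w) := fun w hw => by
      have hzw : z ≠ w := fun h => hzW (h ▸ hw)
      have htw : t ≠ w := fun h => ht (h ▸ hw)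
      rw [Finset.erase_insert_of_ne htw,
        Finset.prod_insert fun h => ht (Finset.mem_of_mem_erase h)]
      linear_combination (∏ y ∈ W.erase w, f c w y) * g c x w * g_mul_f_exchange c hzt hzw htw
    rw [Finset.prod_insert ht, Finset.prod_insert ht, Finset.sum_insert ht,
      Finset.erase_insert ht, Finset.sum_congr rfl hw, Finset.sum_sub_distrib, ← Finset.mul_sum,
      ← Finset.mul_sum]
    have h4 : g c x z * f c z t = g c x z * f c x t + g c z t * g c x t := by
      have h1 := sub_ne_zero.mpr hxz
      have h2 := sub_ne_zero.mpr hxt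
      have h3 := sub_ne_zero.mpr hzt
      simp only [f, g]
      field_simp
      ring
    linear_combination f c z t * h1 - g c z t * h2 + (∏ y ∈ W, f c x y) * h4

/-- Both sides obey the recursion of `reducedIK_recursion`. Coincidences `x i = y j` are allowed, as
the Bethe vectors with a common parameter require. -/
theorem reducedIK_eq_ikNum (hc : c ≠ 0) {k : ℕ} (x y : Fin k → ℂ) (hx : Function.Injective x)
    (hy : Function.Injective y) (hsh : ∀ i j, x i - y j + c ≠ 0) :
    reducedIK c x y = ikNum c (Finset.univ.image x) (Finset.univ.image y) /
      ∏ i, ∏ j, (x i - y j + c) := by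
  induction k with
  | zero => simp [reducedIK, ikPrefactor, ikNum_empty]
  | succ k ih =>
    have hrec := reducedIK_recursion c hc x y hy hsh
    have hy0 : y 0 ∉ Finset.univ.image fun m : Fin k => y m.succ := by
      simp only [Finset.mem_image, Finset.mem_univ, true_and, not_exists]
      exact fun m h => Fin.succ_ne_zero m (hy h)
    have hys : Finset.univ.image y =
        insert (y 0) (Finset.univ.image fun m : Fin k => y m.succ) := by
      rw [Fin.univ_succ, Finset.cons_eq_insert, Finset.image_insert, Finset.map_eq_image,
        Finset.image_image]
      rfl
    have hxs : ∀ i : Fin (k + 1), (Finset.univ.image x).erase (x i) =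
        Finset.univ.image fun l : Fin k => x (i.succAbove l) := by
      intro i
      rw [← Finset.image_erase hx, ← Finset.compl_singleton, ← Fin.image_succAbove_univ,
        Finset.image_image]
      rfl
    have hP : ∀ i, x i - y 0 + c ≠ 0 := fun i => hsh i 0
    have hxi : ∀ i : Fin (k + 1), Function.Injective fun l : Fin k => x (i.succAbove l) :=
      fun i => hx.comp Fin.succAbove_right_injective
    have hyi : Function.Injective fun l : Fin k => y l.succ := hy.comp (Fin.succ_injective k)
    have hP0 : ∏ l, (x l - y 0 + c) ≠ 0 := Finset.prod_ne_zero_iff.mpr fun i _ => hsh i 0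
    have hQ : ∏ i, ∏ j : Fin k, (x i - y j.succ + c) ≠ 0 :=
      Finset.prod_ne_zero_iff.mpr fun i _ => Finset.prod_ne_zero_iff.mpr fun j _ => hsh i _
    have hprod : ∏ i, ∏ j, (x i - y j + c) =
        (∏ l, (x l - y 0 + c)) * ∏ i, ∏ j : Fin k, (x i - y j.succ + c) := by
      simp only [Fin.prod_univ_succ (n := k) (fun j => x _ - y j + c), Finset.prod_mul_distrib]
    rw [hprod, eq_div_iff (mul_ne_zero hP0 hQ), hys, ikNum_insert c hy0,
      Finset.sum_image (fun _ _ _ _ h => hx h), mul_comm (∏ l, (x l - y 0 + c)),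
      mul_comm (reducedIK c x y), mul_assoc, hrec, Finset.mul_sum]
    refine Finset.sum_congr rfl fun i _ => ?_
    have hQ' : ∏ p : Fin k, ∏ j : Fin k, (x (i.succAbove p) - y j.succ + c) ≠ 0 :=
      Finset.prod_ne_zero_iff.mpr fun i _ => Finset.prod_ne_zero_iff.mpr fun j _ => hsh _ _
    rw [ih _ _ (hxi i) hyi fun _ _ => hsh _ _, hxs, Finset.prod_image (fun _ _ _ _ h => hxi i h),
      Finset.prod_image (fun _ _ _ _ h => hyi h), Fin.prod_univ_succAbove _ i]
    field_simp

end Numerator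

/-! ### Reindexing sums over a subset and a distinguished element. -/

section PowersetSums

variable {M : Type*} [AddCommMonoid M]

theorem sum_powerset_sum_mem (u : Finset ℂ) (F : Finset ℂ → ℂ → M) :
    ∑ I ∈ u.powerset, ∑ w ∈ I, F I w =
      ∑ I ∈ u.powerset, ∑ w ∈ u \ I, F (insert w I) w := by
  rw [Finset.sum_sigma', Finset.sum_sigma']
  refine Finset.sum_bij' (fun p _ => ⟨p.1.erase p.2, p.2⟩) (fun p _ => ⟨insert p.2 p.1, p.2⟩)
    ?_ ?_ ?_ ?_ ?_
  · rintro ⟨I, w⟩ h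
    simp only [Finset.mem_sigma, Finset.mem_powerset, Finset.mem_sdiff] at h ⊢
    exact ⟨(Finset.erase_subset _ _).trans h.1, h.1 h.2, Finset.notMem_erase _ _⟩
  · rintro ⟨I, w⟩ h
    simp only [Finset.mem_sigma, Finset.mem_powerset, Finset.mem_sdiff] at h ⊢
    exact ⟨Finset.insert_subset h.2.1 h.1, Finset.mem_insert_self _ _⟩
  · rintro ⟨I, w⟩ h
    simp only [Finset.mem_sigma] at h
    simp [Finset.insert_erase h.2]
  · rintro ⟨I, w⟩ h
    simp only [Finset.mem_sigma, Finset.mem_sdiff] at h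
    simp [Finset.erase_insert h.2.2]
  · rintro ⟨I, w⟩ h
    simp only [Finset.mem_sigma] at h
    simp [Finset.insert_erase h.2]

theorem sum_mem_sum_powerset_erase (v : Finset ℂ) (F : ℂ → Finset ℂ → M) :
    ∑ i ∈ v, ∑ J ∈ (v.erase i).powerset, F i J =
      ∑ J ∈ v.powerset, ∑ i ∈ J, F i (J.erase i) := by
  rw [Finset.sum_sigma', Finset.sum_sigma']
  refine Finset.sum_bij' (fun p _ => ⟨insert p.1 p.2, p.1⟩) (fun p _ => ⟨p.2, p.1.erase p.2⟩)
    ?_ ?_ ?_ ?_ ?_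
  · rintro ⟨i, J⟩ h
    simp only [Finset.mem_sigma, Finset.mem_powerset] at h ⊢
    exact ⟨Finset.insert_subset h.1 (h.2.trans (Finset.erase_subset _ _)),
      Finset.mem_insert_self _ _⟩
  · rintro ⟨J, i⟩ h
    simp only [Finset.mem_sigma, Finset.mem_powerset] at h ⊢
    exact ⟨h.1 h.2, Finset.erase_subset_erase i h.1⟩
  · rintro ⟨i, J⟩ h
    simp only [Finset.mem_sigma, Finset.mem_powerset] at h
    have : i ∉ J := fun hi => Finset.notMem_erase i v (h.2 hi)
    simp [Finset.erase_insert this]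
  · rintro ⟨J, i⟩ h
    simp only [Finset.mem_sigma] at h
    simp [Finset.insert_erase h.2]
  · rintro ⟨i, J⟩ h
    simp only [Finset.mem_sigma, Finset.mem_powerset] at h
    have : i ∉ J := fun hi => Finset.notMem_erase i v (h.2 hi)
    simp [Finset.erase_insert this]

theorem erase_sdiff_erase_of_mem (v : Finset ℂ) {J : Finset ℂ} {i : ℂ} (hi : i ∈ J) :
    v.erase i \ J.erase i = v \ J := by
  ext x
  simp only [Finset.mem_sdiff, Finset.mem_erase]
  constructor
  · rintro ⟨⟨h1, h2⟩, h3⟩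
    exact ⟨h2, fun h => h3 ⟨h1, h⟩⟩
  · rintro ⟨h1, h2⟩
    exact ⟨⟨fun h => h2 (h ▸ hi), h1⟩, fun h => h2 h.2⟩

end PowersetSums

/-! ### The explicit sum over partitions satisfies the nested recursion. -/

section Explicit

variable {V : Type*} [AddCommGroup V] [Module ℂ V]

/-- The product of the operators `X(x)` over a finite set of points. -/
noncomputable def opSet (X : ℂ → Module.End ℂ V) (S : Finset ℂ) : Module.End ℂ V :=
  (S.toList.map X).prod

theorem opSet_empty (X : ℂ → Module.End ℂ V) : opSet X ∅ = 1 := by simp [opSet]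

theorem prod_map_eq_of_perm {X : ℂ → Module.End ℂ V} (hX : ∀ x y φ, X x (X y φ) = X y (X x φ))
    {l l' : List ℂ} (h : l.Perm l') : (l.map X).prod = (l'.map X).prod := by
  refine (h.map X).prod_eq' (List.pairwise_of_forall_mem_list ?_)
  simp only [List.mem_map]
  rintro _ ⟨x, _, rfl⟩ _ ⟨y, _, rfl⟩
  exact LinearMap.ext (hX x y)

theorem opSet_insert {X : ℂ → Module.End ℂ V} (hX : ∀ x y φ, X x (X y φ) = X y (X x φ)) {z : ℂ}
    {S : Finset ℂ} (hz : z ∉ S) (φ : V) : opSet X (insert z S) φ = X z (opSet X S φ) := by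
  rw [opSet, prod_map_eq_of_perm hX (Finset.toList_insert hz), List.map_cons, List.prod_cons]
  rfl

variable {c : ℂ}

theorem RowExchange.apply_opSet {B₂ B₃ : ℂ → Module.End ℂ V} (hB : RowExchange c B₂ B₃)
    (I : Finset ℂ) : ∀ z, z ∉ I → ∀ φ, B₂ z (opSet B₃ I φ) =
      (∏ y ∈ I, f c y z) • opSet B₃ I (B₂ z φ) +
      ∑ w ∈ I, (g c z w * ∏ y ∈ I.erase w, f c y w) •
        B₃ z (opSet B₃ (I.erase w) (B₂ w φ)) := by
  induction I using Finset.induction_on with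
  | empty => simp [opSet_empty]
  | insert t I ht ih =>
    intro z hz φ
    obtain ⟨hzt, hzI⟩ := not_or.mp (Finset.mem_insert.not.mp hz)
    have hw : ∀ w ∈ I, (g c z w * ∏ y ∈ (insert t I).erase w, f c y w) •
          B₃ z (opSet B₃ ((insert t I).erase w) (B₂ w φ)) =
        (f c t z * (g c z w * ∏ y ∈ I.erase w, f c y w)) •
          B₃ t (B₃ z (opSet B₃ (I.erase w) (B₂ w φ))) +
        (g c z t * (g c t w * ∏ y ∈ I.erase w, f c y w)) •
          B₃ z (B₃ t (opSet B₃ (I.erase w) (B₂ w φ))) := fun w hw => by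
      have hzw : z ≠ w := fun h => hzI (h ▸ hw)
      have htw : t ≠ w := fun h => ht (h ▸ hw)
      have ht' : t ∉ I.erase w := fun h => ht (Finset.mem_of_mem_erase h)
      rw [Finset.erase_insert_of_ne htw, Finset.prod_insert ht', opSet_insert hB.comm₃ ht',
        hB.comm₃ t z, ← add_smul]
      congr 1
      linear_combination (-∏ y ∈ I.erase w, f c y w) * g_mul_f_shift c hzt hzw htw
    rw [opSet_insert hB.comm₃ ht, hB.exchange z t hzt, ih z hzI, ih t ht, Finset.prod_insert ht,
      Finset.sum_insert ht, Finset.erase_insert ht, Finset.sum_congr rfl hw,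
      opSet_insert hB.comm₃ ht]
    simp only [map_add, map_sum, map_smul, smul_add, Finset.smul_sum, smul_smul,
      Finset.sum_add_distrib]
    abel

/-- Expanding each determinant in its added element by `ikSet_insert` gives, for every `x ∈ J`, one
instance of `g_mul_prod_f`. -/
theorem ikSet_mul_prod_f {z : ℂ} {I J W : Finset ℂ} (hI : z ∉ I) (hz : z ∉ W) (hW : Disjoint I W)
    (hJ : Disjoint J (insert z (I ∪ W))) :
    ikSet c J (insert z I) * ∏ y ∈ W, f c z y =
      ∑ x ∈ J, (∏ y ∈ J.erase x, f c y x) * (∏ y ∈ I, f c x y) * (∏ y ∈ W, f c x y) *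
        ikSet c (J.erase x) I * g c x z +
      ∑ w ∈ W, ikSet c J (insert w I) * g c z w * ∏ y ∈ W.erase w, f c w y := by
  have hJz : Disjoint J (insert z I) := hJ.mono_right
    (Finset.insert_subset_insert z Finset.subset_union_left)
  have hw : ∀ w ∈ W, ikSet c J (insert w I) * g c z w * ∏ y ∈ W.erase w, f c w y =
      ∑ x ∈ J, (∏ y ∈ J.erase x, f c y x) * (∏ y ∈ I, f c x y) * ikSet c (J.erase x) I *
        (g c z w * (∏ y ∈ W.erase w, f c w y) * g c x w) := fun w hw => by
    have hwI : w ∉ I := fun h => Finset.disjoint_left.mp hW h hw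
    have hJw : Disjoint J (insert w I) := hJ.mono_right (Finset.insert_subset
      (Finset.mem_insert_of_mem (Finset.mem_union_right I hw))
      (Finset.subset_union_left.trans (Finset.subset_insert _ _)))
    rw [ikSet_insert c hwI hJw, Finset.sum_mul, Finset.sum_mul]
    exact Finset.sum_congr rfl fun x _ => by ring
  rw [ikSet_insert c hI hJz, Finset.sum_mul, Finset.sum_congr rfl hw, Finset.sum_comm,
    ← Finset.sum_add_distrib]
  refine Finset.sum_congr rfl fun x hx => ?_
  have hxz : x ≠ z := fun h => Finset.disjoint_left.mp hJ hx (h ▸ Finset.mem_insert_self _ _)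
  have hxW : x ∉ W := fun h => Finset.disjoint_left.mp hJ hx
    (Finset.mem_insert_of_mem (Finset.mem_union_right I h))
  rw [← Finset.mul_sum]
  linear_combination (∏ y ∈ J.erase x, f c y x) * (∏ y ∈ I, f c x y) * ikSet c (J.erase x) I *
    g_mul_prod_f c hxz hxW hz

/-- The coefficient `λ(v̄_I) K(v̄_I|ū_I) f(v̄_II,v̄_I) f(ū_I,ū_II)`. -/
noncomputable def numCoeff (c : ℂ) (lam : ℂ → ℂ) (u v I J : Finset ℂ) : ℂ :=
  (∏ x ∈ J, lam x) * ikSet c J I * (∏ y ∈ v \ J, ∏ x ∈ J, f c y x) * ∏ x ∈ I, ∏ y ∈ u \ I, f c x y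

/-- The Bethe vector multiplied by `λ₂(ū) λ₂(v̄) f(v̄,ū)`. -/
noncomputable def betheNum (c : ℂ) (T : Fin 3 → Fin 3 → ℂ → Module.End ℂ V) (lam : ℂ → ℂ) (vac : V)
    (u v : Finset ℂ) : V :=
  ∑ I ∈ u.powerset, ∑ J ∈ v.powerset, numCoeff c lam u v I J •
    opSet (T 0 2) I (opSet (T 0 1) (u \ I) (opSet (T 1 2) (v \ J) vac))

/-- The coefficient comparison for partitions with `z` in the first part: one sum comes from the
`T₁₃(z)` terms of the recursion, the other from exchanging `T₁₂(z)` with some `T₁₃(w)`. Without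
common factors it is `ikSet_mul_prod_f` for `W = u \ I`. -/
theorem numCoeff_recursion (lam : ℂ → ℂ) {z : ℂ} {u v I J : Finset ℂ} (hz : z ∉ u)
    (hdis : Disjoint (insert z u) v) (hI : I ⊆ u) (hJ : J ⊆ v) :
    numCoeff c lam (insert z u) v (insert z I) J =
      ∑ i ∈ J, rowWeight c lam u v i * g c i z * numCoeff c lam u (v.erase i) I (J.erase i) +
      ∑ w ∈ u \ I, numCoeff c lam u v (insert w I) J * (g c z w * ∏ y ∈ I, f c y w) := by
  have hzI : z ∉ I := fun h => hz (hI h)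
  have hzW : z ∉ u \ I := fun h => hz (Finset.mem_sdiff.mp h).1
  have key := ikSet_mul_prod_f (c := c) hzI hzW Finset.disjoint_sdiff
    (J := J) (by rw [Finset.union_sdiff_of_subset hI]; exact (hdis.mono_right hJ).symm)
  have hi : ∀ i ∈ J, rowWeight c lam u v i * g c i z *
      numCoeff c lam u (v.erase i) I (J.erase i) =
      (∏ x ∈ J, lam x) * (∏ y ∈ v \ J, ∏ x ∈ J, f c y x) * (∏ x ∈ I, ∏ y ∈ u \ I, f c x y) *
      ((∏ y ∈ J.erase i, f c y i) * (∏ y ∈ I, f c i y) * (∏ y ∈ u \ I, f c i y) *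
        ikSet c (J.erase i) I * g c i z) := fun i hi => by
    have h1 : v.erase i \ J.erase i = v \ J := erase_sdiff_erase_of_mem v hi
    have h2 : ∏ k ∈ v.erase i, f c k i =
        (∏ y ∈ v \ J, f c y i) * ∏ y ∈ J.erase i, f c y i := by
      rw [← h1, Finset.prod_sdiff (Finset.erase_subset_erase i hJ)]
    have h3 : ∏ j ∈ u, f c i j = (∏ y ∈ u \ I, f c i y) * ∏ y ∈ I, f c i y :=
      (Finset.prod_sdiff hI).symm
    have h4 : ∏ y ∈ v \ J, ∏ x ∈ J, f c y x =
        (∏ y ∈ v \ J, f c y i) * ∏ y ∈ v \ J, ∏ x ∈ J.erase i, f c y x := by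
      rw [← Finset.prod_mul_distrib]
      exact Finset.prod_congr rfl fun y _ => (Finset.mul_prod_erase J (fun x => f c y x) hi).symm
    rw [numCoeff, rowWeight, h1, h2, h3, h4, ← Finset.mul_prod_erase J lam hi]
    ring
  have hw : ∀ w ∈ u \ I, numCoeff c lam u v (insert w I) J * (g c z w * ∏ y ∈ I, f c y w) =
      (∏ x ∈ J, lam x) * (∏ y ∈ v \ J, ∏ x ∈ J, f c y x) * (∏ x ∈ I, ∏ y ∈ u \ I, f c x y) *
      (ikSet c J (insert w I) * g c z w * ∏ y ∈ (u \ I).erase w, f c w y) := fun w hw => by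
    have hwI := (Finset.mem_sdiff.mp hw).2
    have h1 : u \ insert w I = (u \ I).erase w := by
      rw [Finset.sdiff_insert]
    have h2 : ∏ x ∈ I, ∏ y ∈ u \ I, f c x y =
        (∏ x ∈ I, f c x w) * ∏ x ∈ I, ∏ y ∈ (u \ I).erase w, f c x y := by
      rw [← Finset.prod_mul_distrib]
      exact Finset.prod_congr rfl fun x _ => (Finset.mul_prod_erase _ (fun y => f c x y) hw).symm
    rw [numCoeff, h1, h2, Finset.prod_insert hwI]
    ring
  rw [Finset.sum_congr rfl hi, Finset.sum_congr rfl hw, ← Finset.mul_sum, ← Finset.mul_sum,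
    ← mul_add, ← key, numCoeff, Finset.insert_sdiff_insert, Finset.sdiff_insert_of_notMem hz,
    Finset.prod_insert hzI]
  ring

/-- When `T₁₂(z)` moves through `T₁₃(ū_I)`, the direct terms give the partitions with `z` in `ū_II`;
the exchange terms, together with the `T₁₃(z)` sum, give those with `z` in `ū_I`. -/
theorem betheNum_isNested {T : Fin 3 → Fin 3 → ℂ → Module.End ℂ V} (hT : RTT c T) (hc : c ≠ 0)
    (lam : ℂ → ℂ) (vac : V) :
    IsNested c lam (T 0 1) (T 0 2) (betheNum c T lam vac) := by
  intro z u v hz hdis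
  have hB := hT.rowExchange_first hc
  set W : Finset ℂ → Finset ℂ → V := fun I J =>
    T 0 2 z (opSet (T 0 2) I (opSet (T 0 1) (u \ I) (opSet (T 1 2) (v \ J) vac))) with hW
  have hfirst : ∀ I ∈ u.powerset, ∀ J ∈ v.powerset, numCoeff c lam u v I J •
      T 0 1 z (opSet (T 0 2) I (opSet (T 0 1) (u \ I) (opSet (T 1 2) (v \ J) vac))) =
      numCoeff c lam (insert z u) v I J •
        opSet (T 0 2) I (opSet (T 0 1) (insert z u \ I) (opSet (T 1 2) (v \ J) vac)) +
      ∑ w ∈ I, (numCoeff c lam u v I J * (g c z w * ∏ y ∈ I.erase w, f c y w)) •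
        W (I.erase w) J := by
    intro I hI J _
    have hIu := Finset.mem_powerset.mp hI
    have hzI : z ∉ I := fun h => hz (hIu h)
    have hzW : z ∉ u \ I := fun h => hz (Finset.mem_sdiff.mp h).1
    rw [hB.apply_opSet I z hzI, Finset.insert_sdiff_of_notMem u hzI, opSet_insert hB.comm₂ hzW,
      smul_add, Finset.smul_sum, smul_smul]
    congr 1
    · congr 1
      simp only [numCoeff, Finset.insert_sdiff_of_notMem u hzI, Finset.prod_insert hzW,
        Finset.prod_mul_distrib]
      ring
    · refine Finset.sum_congr rfl fun w hw => ?_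
      have hwW : w ∉ u \ I := fun h => (Finset.mem_sdiff.mp h).2 hw
      have : u \ I.erase w = insert w (u \ I) := by
        rw [Finset.sdiff_erase (hIu hw)]
      simp only [hW, this, opSet_insert hB.comm₂ hwW, smul_smul]
  have hsecond : ∑ i ∈ v, (rowWeight c lam u v i * g c i z) •
      T 0 2 z (betheNum c T lam vac u (v.erase i)) =
      ∑ I ∈ u.powerset, ∑ J ∈ v.powerset, ∑ i ∈ J,
        (rowWeight c lam u v i * g c i z * numCoeff c lam u (v.erase i) I (J.erase i)) •
          W I J := by
    simp only [betheNum, map_sum, map_smul, Finset.smul_sum, smul_smul]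
    rw [Finset.sum_comm]
    refine Finset.sum_congr rfl fun I _ => ?_
    rw [sum_mem_sum_powerset_erase]
    refine Finset.sum_congr rfl fun J hJ => Finset.sum_congr rfl fun i hi => ?_
    have h1 : v.erase i \ J.erase i = v \ J := erase_sdiff_erase_of_mem v hi
    simp only [h1, hW]
  have hthird : ∑ I ∈ u.powerset, ∑ J ∈ v.powerset, ∑ w ∈ I,
      (numCoeff c lam u v I J * (g c z w * ∏ y ∈ I.erase w, f c y w)) • W (I.erase w) J =
      ∑ I ∈ u.powerset, ∑ J ∈ v.powerset, ∑ w ∈ u \ I,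
        (numCoeff c lam u v (insert w I) J * (g c z w * ∏ y ∈ I, f c y w)) • W I J := by
    rw [Finset.sum_comm, Finset.sum_comm (s := u.powerset)]
    refine Finset.sum_congr rfl fun J _ => ?_
    rw [sum_powerset_sum_mem]
    refine Finset.sum_congr rfl fun I _ => Finset.sum_congr rfl fun w hw => ?_
    rw [Finset.erase_insert (Finset.mem_sdiff.mp hw).2]
  rw [raise, hsecond]
  conv_rhs => rw [betheNum]
  simp only [map_sum, map_smul]
  rw [Finset.sum_congr rfl fun I hI => Finset.sum_congr rfl fun J hJ => hfirst I hI J hJ]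
  simp only [Finset.sum_add_distrib]
  rw [hthird, betheNum, Finset.sum_powerset_insert hz, add_assoc]
  congr 1
  simp only [← Finset.sum_add_distrib]
  refine Finset.sum_congr rfl fun I hI => Finset.sum_congr rfl fun J hJ => ?_
  have hIu := Finset.mem_powerset.mp hI
  have hzI : z ∉ I := fun h => hz (hIu h)
  rw [numCoeff_recursion lam hz hdis hIu (Finset.mem_powerset.mp hJ), opSet_insert hB.comm₃ hzI,
    Finset.insert_sdiff_insert, Finset.sdiff_insert_of_notMem hz, ← Finset.sum_smul,
    ← Finset.sum_smul, ← add_smul, add_comm]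

end Explicit

/-! ### From Bethe vectors over indexed families to `betheNum` over sets. -/

section Link

variable {V : Type*} [AddCommGroup V] [Module ℂ V] {c : ℂ}

theorem betheNum_empty_left (c : ℂ) (T : Fin 3 → Fin 3 → ℂ → Module.End ℂ V) (lam : ℂ → ℂ)
    (vac : V) (v : Finset ℂ) : betheNum c T lam vac ∅ v = opSet (T 1 2) v vac := by
  have h : ∀ J : Finset ℂ, ikSet c J ∅ = if J = ∅ then 1 else 0 := fun J => by
    simp [ikSet, ikNum_empty]
  rw [betheNum, Finset.powerset_empty, Finset.sum_singleton, Finset.sum_eq_single ∅]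
  · simp [numCoeff, h, opSet_empty]
  · intro J _ hJ
    simp [numCoeff, h, hJ]
  · simp

/-- The coefficient of the Bethe vector in terms of sets of parameters. -/
noncomputable def setCoeff (c : ℂ) (lam : ℂ → ℂ) (u v I J : Finset ℂ) : ℂ :=
  ikNum c J I / (∏ x ∈ J, ∏ y ∈ I, (x - y + c)) * (∏ y ∈ v \ J, ∏ x ∈ J, f c y x) *
      (∏ x ∈ I, ∏ y ∈ u \ I, f c x y) /
    ((∏ y ∈ v \ J, lam y) * (∏ x ∈ u, lam x) *
      ((∏ x ∈ J, ∏ y ∈ u \ I, f c x y) * ∏ x ∈ v \ J, ∏ y ∈ u, f c x y))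

theorem reducedIK_orderEmb (hc : c ≠ 0) {a b : ℕ} {u : Fin a → ℂ} {v : Fin b → ℂ}
    (hu : Function.Injective u) (hv : Function.Injective v) (hsh : ∀ i j, v j - u i + c ≠ 0)
    (I : Finset (Fin a)) (J : Finset (Fin b)) (hIJ : J.card = I.card) :
    reducedIK c (fun k => v (J.orderEmbOfFin hIJ k)) (fun k => u (I.orderEmbOfFin rfl k)) =
      ikNum c (J.image v) (I.image u) / ∏ x ∈ J.image v, ∏ y ∈ I.image u, (x - y + c) := by
  have key : ∀ {n k : ℕ} (S : Finset (Fin n)) (hS : S.card = k) (F : Fin n → ℂ),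
      Finset.univ.image (fun q : Fin k => F (S.orderEmbOfFin hS q)) = S.image F := by
    intro n k S hS F
    have h := congrArg (Finset.image F) (Finset.image_orderEmbOfFin_univ S hS)
    rwa [Finset.image_image] at h
  have hvJ : Function.Injective fun k => v (J.orderEmbOfFin hIJ k) :=
    hv.comp (J.orderEmbOfFin hIJ).injective
  have huI : Function.Injective fun k => u (I.orderEmbOfFin rfl k) :=
    hu.comp (I.orderEmbOfFin rfl).injective
  rw [reducedIK_eq_ikNum c hc _ _ hvJ huI fun _ _ => hsh _ _, key, key, ← key J hIJ v,
    ← key I rfl u, Finset.prod_image fun _ _ _ _ h => hvJ h]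
  congr 1
  exact Finset.prod_congr rfl fun p _ => by rw [Finset.prod_image fun _ _ _ _ h => huI h]

theorem fProd_eq {m n : ℕ} {x : Fin m → ℂ} {y : Fin n → ℂ} (hx : Function.Injective x)
    (hy : Function.Injective y) (S : Finset (Fin m)) (S' : Finset (Fin n)) :
    fProd c x S y S' = ∏ s ∈ S.image x, ∏ t ∈ S'.image y, f c s t := by
  rw [fProd, Finset.prod_image fun _ _ _ _ h => hx h]
  exact Finset.prod_congr rfl fun p _ => (Finset.prod_image fun _ _ _ _ h => hy h).symm

theorem image_compl_eq {n : ℕ} {x : Fin n → ℂ} (hx : Function.Injective x)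
    (S : Finset (Fin n)) : Sᶜ.image x = Finset.univ.image x \ S.image x := by
  rw [Finset.compl_eq_univ_sdiff, Finset.image_sdiff _ _ hx]

theorem opProd_eq {X : ℂ → Module.End ℂ V} (hX : ∀ x y φ, X x (X y φ) = X y (X x φ)) {n : ℕ}
    {x : Fin n → ℂ} (hx : Function.Injective x) (S : Finset (Fin n)) :
    opProd X x S = opSet X (S.image x) := by
  have hperm : ((S.sort (fun i j => i ≤ j)).map x).Perm (S.image x).toList := by
    rw [List.perm_ext_iff_of_nodup ((Finset.sort_nodup _ _).map hx) (Finset.nodup_toList _)]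
    intro z
    simp
  rw [opSet, ← prod_map_eq_of_perm hX hperm, List.map_map]
  rfl

theorem sum_powerset_image {M : Type*} [AddCommMonoid M] {n : ℕ} {x : Fin n → ℂ}
    (hx : Function.Injective x) (F : Finset ℂ → M) :
    ∑ S ∈ (Finset.univ.image x).powerset, F S = ∑ S : Finset (Fin n), F (S.image x) := by
  rw [Finset.powerset_image, Finset.sum_image fun _ _ _ _ h => Finset.image_injective hx h,
    Finset.powerset_univ]

/-- The two families may share values here, so the formula also covers `w` replacing both a `u_j`
and a `v_i`. -/
theorem betheVector_eq_sum {T : Fin 3 → Fin 3 → ℂ → Module.End ℂ V} (hT : RTT c T) (hc : c ≠ 0)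
    (lam : Fin 3 → ℂ → ℂ) (vac : V) {a b : ℕ} {u : Fin a → ℂ} {v : Fin b → ℂ}
    (hu : Function.Injective u) (hv : Function.Injective v) (hsh : ∀ i j, v j - u i + c ≠ 0) :
    betheVector c T lam vac u v =
      ∑ I ∈ (Finset.univ.image u).powerset, ∑ J ∈ (Finset.univ.image v).powerset,
        setCoeff c (lam 1) (Finset.univ.image u) (Finset.univ.image v) I J •
          opSet (T 0 2) I (opSet (T 0 1) (Finset.univ.image u \ I)
            (opSet (T 1 2) (Finset.univ.image v \ J) vac)) := by
  rw [betheVector, sum_powerset_image hu]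
  refine Finset.sum_congr rfl fun I _ => ?_
  rw [sum_powerset_image hv]
  refine Finset.sum_congr rfl fun J _ => ?_
  split_ifs with hIJ
  · have h1 : ∏ j ∈ Jᶜ, lam 1 (v j) = ∏ y ∈ Jᶜ.image v, lam 1 y :=
      (Finset.prod_image fun _ _ _ _ h => hv h).symm
    have h2 : ∏ i, lam 1 (u i) = ∏ y ∈ Finset.univ.image u, lam 1 y :=
      (Finset.prod_image fun _ _ _ _ h => hu h).symm
    rw [opProd_eq (hT.commute_same hc 0 2) hu, opProd_eq (hT.commute_same hc 0 1) hu,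
      opProd_eq (hT.commute_same hc 1 2) hv, image_compl_eq hu, image_compl_eq hv,
      Module.End.mul_apply, Module.End.mul_apply, bvCoeff, h1, h2, reducedIK_orderEmb hc hu hv hsh,
      setCoeff, fProd_eq hv hv, fProd_eq hu hu, fProd_eq hv hu, fProd_eq hv hu,
      image_compl_eq hu, image_compl_eq hv]
  · have : (J.image v).card ≠ (I.image u).card := by
      rwa [Finset.card_image_of_injective _ hu, Finset.card_image_of_injective _ hv]
    rw [setCoeff, ikNum_eq_zero c this]
    simp

theorem setCoeff_eq (lam : ℂ → ℂ) {u v I J : Finset ℂ} (huv : Disjoint u v)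
    (hsh : ∀ x ∈ v, ∀ y ∈ u, x - y + c ≠ 0) (hlv : ∀ x ∈ v, lam x ≠ 0) (hI : I ⊆ u) (hJ : J ⊆ v) :
    setCoeff c lam u v I J =
      ((∏ x ∈ u, lam x) * (∏ y ∈ v, lam y) * ∏ x ∈ v, ∏ y ∈ u, f c x y)⁻¹ *
        numCoeff c lam u v I J := by
  have hsub : ∀ x ∈ v, ∀ y ∈ u, x - y ≠ 0 := fun x hx y hy =>
    sub_ne_zero.mpr fun h => Finset.disjoint_left.mp huv hy (h ▸ hx)
  have h1 : ∏ x ∈ v, ∏ y ∈ u, f c x y = (∏ x ∈ J, ∏ y ∈ I, f c x y) *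
      ((∏ x ∈ J, ∏ y ∈ u \ I, f c x y) * ∏ x ∈ v \ J, ∏ y ∈ u, f c x y) := by
    rw [← Finset.prod_sdiff hJ, ← mul_assoc, ← Finset.prod_mul_distrib, mul_comm]
    congr 1
    refine Finset.prod_congr rfl fun x _ => ?_
    rw [mul_comm, Finset.prod_sdiff hI]
  have h2 : ∏ x ∈ J, ∏ y ∈ I, f c x y =
      (∏ x ∈ J, ∏ y ∈ I, (x - y + c)) / ∏ x ∈ J, ∏ y ∈ I, (x - y) := by
    simp only [f, Finset.prod_div_distrib]
  have h3 : ∏ x ∈ J, ∏ y ∈ I, (x - y + c) ≠ 0 := Finset.prod_ne_zero_iff.mpr fun x hx =>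
    Finset.prod_ne_zero_iff.mpr fun y hy => hsh x (hJ hx) y (hI hy)
  have h4 : ∏ x ∈ J, ∏ y ∈ I, (x - y) ≠ 0 := Finset.prod_ne_zero_iff.mpr fun x hx =>
    Finset.prod_ne_zero_iff.mpr fun y hy => hsub x (hJ hx) y (hI hy)
  have h5 : ∏ x ∈ J, lam x ≠ 0 := Finset.prod_ne_zero_iff.mpr fun x hx => hlv x (hJ hx)
  rw [setCoeff, numCoeff, ikSet, h1, h2, ← Finset.prod_sdiff hJ]
  simp only [mul_inv, div_eq_mul_inv, inv_inv]
  field_simp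

theorem betheVector_eq_betheNum {T : Fin 3 → Fin 3 → ℂ → Module.End ℂ V} (hT : RTT c T)
    (hc : c ≠ 0) (lam : Fin 3 → ℂ → ℂ) (vac : V) {a b : ℕ} {u : Fin a → ℂ} {v : Fin b → ℂ}
    (hu : Function.Injective u) (hv : Function.Injective v) (huv : ∀ i j, u i ≠ v j)
    (hsh : ∀ i j, v j - u i + c ≠ 0) (hlv : ∀ j, lam 1 (v j) ≠ 0) :
    betheVector c T lam vac u v =
      ((∏ i, lam 1 (u i)) * (∏ j, lam 1 (v j)) * ∏ j, ∏ i, f c (v j) (u i))⁻¹ •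
        betheNum c T (lam 1) vac (Finset.univ.image u) (Finset.univ.image v) := by
  have hdis : Disjoint (Finset.univ.image u) (Finset.univ.image v) := by
    rw [Finset.disjoint_left]
    simp only [Finset.mem_image, Finset.mem_univ, true_and]
    rintro _ ⟨i, rfl⟩ ⟨j, h⟩
    exact huv i j h.symm
  have hsh' : ∀ x ∈ Finset.univ.image v, ∀ y ∈ Finset.univ.image u, x - y + c ≠ 0 := by
    simp only [Finset.mem_image, Finset.mem_univ, true_and]
    rintro _ ⟨j, rfl⟩ _ ⟨i, rfl⟩
    exact hsh i j
  have hlv' : ∀ x ∈ Finset.univ.image v, lam 1 x ≠ 0 := by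
    simp only [Finset.mem_image, Finset.mem_univ, true_and]
    rintro _ ⟨j, rfl⟩
    exact hlv j
  have e : (∏ i, lam 1 (u i)) * (∏ j, lam 1 (v j)) * ∏ j, ∏ i, f c (v j) (u i) =
      (∏ x ∈ Finset.univ.image u, lam 1 x) * (∏ y ∈ Finset.univ.image v, lam 1 y) *
        ∏ x ∈ Finset.univ.image v, ∏ y ∈ Finset.univ.image u, f c x y := by
    simp only [Finset.prod_image fun _ _ _ _ h => hu h, Finset.prod_image fun _ _ _ _ h => hv h]
  rw [betheVector_eq_sum hT hc lam vac hu hv hsh, betheNum, e]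
  simp only [Finset.smul_sum, smul_smul]
  refine Finset.sum_congr rfl fun I hI => Finset.sum_congr rfl fun J hJ => ?_
  rw [setCoeff_eq (lam 1) hdis hsh' hlv' (Finset.mem_powerset.mp hI) (Finset.mem_powerset.mp hJ)]

/-- In the recursion in `w`, every summand with `x ≠ w` contains the factor `w - w`. -/
theorem ikNum_insert_insert {w : ℂ} {I J : Finset ℂ} (hI : w ∉ I) (hJ : w ∉ J) :
    ikNum c (insert w J) (insert w I) =
      c * (∏ x ∈ J, (x - w + c)) * (∏ y ∈ I, (w - y + c)) * ikNum c J I := by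
  rw [ikNum_insert c hI, Finset.sum_insert hJ, Finset.erase_insert hJ, Finset.sum_eq_zero, add_zero]
  · congr 3
    refine Finset.prod_congr rfl fun x hx => ?_
    have : x - w ≠ 0 := sub_ne_zero.mpr fun h => hJ (h ▸ hx)
    rw [f, div_mul_cancel₀ _ this]
  · intro x hx
    have hw : w ∈ (insert w J).erase x :=
      Finset.mem_erase.mpr ⟨fun h => hJ (h ▸ hx), Finset.mem_insert_self w J⟩
    rw [Finset.prod_eq_zero hw (by simp)]
    ring

/-- The denominator contains `f c w w`, which is `0` here, so the quotient is `0`: the correct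
value, since the rational function `1 / f` vanishes at coinciding arguments. -/
theorem setCoeff_eq_zero_of_left (lam : ℂ → ℂ) {w : ℂ} {u v I J : Finset ℂ} (hwu : w ∈ u)
    (hwv : w ∈ v) (hwJ : w ∉ J) : setCoeff c lam u v I J = 0 := by
  have : ∏ x ∈ v \ J, ∏ y ∈ u, f c x y = 0 :=
    Finset.prod_eq_zero (Finset.mem_sdiff.mpr ⟨hwv, hwJ⟩)
      (Finset.prod_eq_zero hwu (by simp [f]))
  simp [setCoeff, this]

theorem setCoeff_eq_zero_of_right (lam : ℂ → ℂ) {w : ℂ} {u v I J : Finset ℂ} (hwu : w ∈ u)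
    (hwI : w ∉ I) (hwJ : w ∈ J) : setCoeff c lam u v I J = 0 := by
  have : ∏ x ∈ J, ∏ y ∈ u \ I, f c x y = 0 :=
    Finset.prod_eq_zero hwJ (Finset.prod_eq_zero (Finset.mem_sdiff.mpr ⟨hwu, hwI⟩) (by simp [f]))
  simp [setCoeff, this]

/-- The factors `f(·,w)` and `f(w,·)` cancel between numerator and denominator, and the shifted
products cancel against `ikNum_insert_insert`; only `λ(w)` from the product over `u` survives. -/
theorem setCoeff_insert_insert (lam : ℂ → ℂ) (hc : c ≠ 0) {w : ℂ} {u v I J : Finset ℂ}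
    (hwu : w ∉ u) (hwv : w ∉ v) (hu : ∀ y ∈ u, w - y + c ≠ 0) (hv : ∀ x ∈ v, x - w + c ≠ 0)
    (hI : I ⊆ u) (hJ : J ⊆ v) :
    setCoeff c lam (insert w u) (insert w v) (insert w I) (insert w J) =
      (lam w)⁻¹ * setCoeff c lam u v I J := by
  have hwI : w ∉ I := fun h => hwu (hI h)
  have hwJ : w ∉ J := fun h => hwv (hJ h)
  have e1 : insert w v \ insert w J = v \ J := by
    rw [Finset.insert_sdiff_insert, Finset.sdiff_insert_of_notMem hwv]
  have e2 : insert w u \ insert w I = u \ I := by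
    rw [Finset.insert_sdiff_insert, Finset.sdiff_insert_of_notMem hwu]
  have hne : ∀ {s : Finset ℂ} {F : ℂ → ℂ}, (∀ x ∈ s, F x ≠ 0) → ∏ x ∈ s, F x ≠ 0 :=
    fun h => Finset.prod_ne_zero_iff.mpr h
  have h1 : ∏ x ∈ J, (x - w + c) ≠ 0 := hne fun x hx => hv x (hJ hx)
  have h2 : ∏ y ∈ I, (w - y + c) ≠ 0 := hne fun y hy => hu y (hI hy)
  have h3 : ∏ y ∈ u \ I, f c w y ≠ 0 := hne fun y hy => by
    have hy' := (Finset.mem_sdiff.mp hy).1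
    exact div_ne_zero (hu y hy') (sub_ne_zero.mpr fun h => hwu (h ▸ hy'))
  have h4 : ∏ x ∈ v \ J, f c x w ≠ 0 := hne fun x hx => by
    have hx' := (Finset.mem_sdiff.mp hx).1
    exact div_ne_zero (hv x hx') (sub_ne_zero.mpr fun h => hwv (h ▸ hx'))
  simp only [setCoeff, e1, e2, ikNum_insert_insert hwI hwJ, Finset.prod_insert hwI,
    Finset.prod_insert hwJ, Finset.prod_insert hwu, Finset.prod_mul_distrib, sub_self, zero_add]
  simp only [div_eq_mul_inv, mul_inv]
  field_simp

/-- A parameter that occurs in both sets splits off as `T₁₃(w) / λ₂(w)`. -/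
theorem betheVector_of_common {T : Fin 3 → Fin 3 → ℂ → Module.End ℂ V} (hT : RTT c T)
    (hc : c ≠ 0) (lam : Fin 3 → ℂ → ℂ) (vac : V) {a b : ℕ} {u : Fin a → ℂ} {v : Fin b → ℂ}
    (hu : Function.Injective u) (hv : Function.Injective v) (hsh : ∀ i j, v j - u i + c ≠ 0)
    {w : ℂ} {U W : Finset ℂ} (hwU : w ∉ U) (hwW : w ∉ W) (hUW : Disjoint U W)
    (huU : Finset.univ.image u = insert w U) (hvW : Finset.univ.image v = insert w W)
    (hlv : ∀ x ∈ W, lam 1 x ≠ 0) :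
    betheVector c T lam vac u v =
      (lam 1 w * ((∏ x ∈ U, lam 1 x) * (∏ y ∈ W, lam 1 y) * ∏ x ∈ W, ∏ y ∈ U, f c x y))⁻¹ •
        T 0 2 w (betheNum c T (lam 1) vac U W) := by
  have hsh' : ∀ x ∈ insert w W, ∀ y ∈ insert w U, x - y + c ≠ 0 := by
    simp only [← huU, ← hvW, Finset.mem_image, Finset.mem_univ, true_and]
    rintro _ ⟨j, rfl⟩ _ ⟨i, rfl⟩
    exact hsh i j
  have hU : ∀ y ∈ U, w - y + c ≠ 0 := fun y hy =>
    hsh' w (Finset.mem_insert_self w W) y (Finset.mem_insert_of_mem hy)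
  have hW : ∀ x ∈ W, x - w + c ≠ 0 := fun x hx =>
    hsh' x (Finset.mem_insert_of_mem hx) w (Finset.mem_insert_self w U)
  rw [betheVector_eq_sum hT hc lam vac hu hv hsh, huU, hvW, Finset.sum_powerset_insert hwU,
    Finset.sum_eq_zero, zero_add, betheNum]
  · simp only [map_sum, map_smul, Finset.smul_sum, smul_smul]
    refine Finset.sum_congr rfl fun I hI => ?_
    have hI' := Finset.mem_powerset.mp hI
    rw [Finset.sum_powerset_insert hwW, Finset.sum_eq_zero, zero_add]
    · refine Finset.sum_congr rfl fun J hJ => ?_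
      have hJ' := Finset.mem_powerset.mp hJ
      rw [setCoeff_insert_insert (lam 1) hc hwU hwW hU hW hI' hJ', setCoeff_eq (lam 1) hUW
        (fun x hx y hy => hsh' x (Finset.mem_insert_of_mem hx) y (Finset.mem_insert_of_mem hy))
        hlv hI' hJ', Finset.insert_sdiff_insert, Finset.sdiff_insert_of_notMem hwU,
        Finset.insert_sdiff_insert, Finset.sdiff_insert_of_notMem hwW,
        opSet_insert (hT.commute_same hc 0 2) fun h => hwU (hI' h)]
      congr 1
      rw [mul_inv (lam 1 w), mul_assoc (lam 1 w)⁻¹]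
    · intro J hJ
      rw [setCoeff_eq_zero_of_left (lam 1) (Finset.mem_insert_self w U)
        (Finset.mem_insert_self w W) fun h => hwW (Finset.mem_powerset.mp hJ h), zero_smul]
  · intro I hI
    refine Finset.sum_eq_zero fun J hJ => ?_
    by_cases hwJ : w ∈ J
    · rw [setCoeff_eq_zero_of_right (lam 1) (Finset.mem_insert_self w U)
        (fun h => hwU (Finset.mem_powerset.mp hI h)) hwJ, zero_smul]
    · rw [setCoeff_eq_zero_of_left (lam 1) (Finset.mem_insert_self w U)
        (Finset.mem_insert_self w W) hwJ, zero_smul]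

end Link

/-! ### Restoring the normalization: the off-shell action and the eigenvector property. -/

section Main

theorem prod_erase_image {M : Type*} [CommMonoid M] {n : ℕ} {x : Fin n → ℂ}
    (hx : Function.Injective x) (j : Fin n) (F : ℂ → M) :
    ∏ k ∈ (Finset.univ.image x).erase (x j), F k = ∏ k ∈ Finset.univ.erase j, F (x k) := by
  rw [← Finset.image_erase hx, Finset.prod_image fun _ _ _ _ h => hx h]

theorem prod_update_mul {n : ℕ} (x : Fin n → ℂ) (j : Fin n) (w : ℂ) (F : ℂ → ℂ) :
    (∏ i, F (Function.update x j w i)) * F (x j) = (∏ i, F (x i)) * F w := by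
  rw [← Finset.mul_prod_erase Finset.univ _ (Finset.mem_univ j),
    ← Finset.mul_prod_erase Finset.univ (fun i => F (x i)) (Finset.mem_univ j),
    Finset.prod_congr rfl fun i hi => by
      rw [Function.update_of_ne (Finset.ne_of_mem_erase hi)], Function.update_self]
  ring

theorem injective_update {n : ℕ} {x : Fin n → ℂ} (hx : Function.Injective x) {w : ℂ}
    (hw : ∀ i, w ≠ x i) (j : Fin n) : Function.Injective (Function.update x j w) := by
  intro p q h
  by_cases hp : p = j <;> by_cases hq : q = j
  · rw [hp, hq]
  · subst hp
    rw [Function.update_self, Function.update_of_ne hq] at h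
    exact absurd h (hw q)
  · subst hq
    rw [Function.update_self, Function.update_of_ne hp] at h
    exact absurd h.symm (hw p)
  · rw [Function.update_of_ne hp, Function.update_of_ne hq] at h
    exact hx h

theorem image_update {n : ℕ} {x : Fin n → ℂ} (hx : Function.Injective x) (w : ℂ) (j : Fin n) :
    Finset.univ.image (Function.update x j w) =
      insert w ((Finset.univ.image x).erase (x j)) := by
  rw [← Finset.image_erase hx, ← Finset.insert_erase (Finset.mem_univ j), Finset.image_insert,
    Function.update_self, Finset.insert_erase (Finset.mem_univ j)]
  congr 1
  exact Finset.image_congr fun i hi =>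
    Function.update_of_ne (Finset.ne_of_mem_erase (Finset.mem_coe.mp hi)) _ _

theorem forall_update {n : ℕ} {x : Fin n → ℂ} {p : ℂ → Prop} (hx : ∀ i, p (x i)) {w : ℂ}
    (hw : p w) (j i : Fin n) : p (Function.update x j w i) := by
  by_cases hi : i = j
  · rwa [hi, Function.update_self]
  · rw [Function.update_of_ne hi]
    exact hx i

variable {V : Type*} [AddCommGroup V] [Module ℂ V] {c : ℂ}
  {T : Fin 3 → Fin 3 → ℂ → Module.End ℂ V} {lam : Fin 3 → ℂ → ℂ} {a b : ℕ}

theorem colWeight_image (lam : ℂ → ℂ) {u : Fin a → ℂ} {v : Fin b → ℂ}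
    (hu : Function.Injective u) (hv : Function.Injective v) (j : Fin a) :
    colWeight c lam (Finset.univ.image u) (Finset.univ.image v) (u j) =
      lam (u j) * (∏ k, f c (v k) (u j)) * fRight c u j := by
  rw [colWeight, prod_erase_image hu, Finset.prod_image fun _ _ _ _ h => hv h, fRight]

theorem rowWeight_image (lam : ℂ → ℂ) {u : Fin a → ℂ} {v : Fin b → ℂ}
    (hu : Function.Injective u) (hv : Function.Injective v) (i : Fin b) :
    rowWeight c lam (Finset.univ.image u) (Finset.univ.image v) (v i) =
      lam (v i) * fLeft c v i * ∏ k, f c (v i) (u k) := by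
  rw [rowWeight, prod_erase_image hv, Finset.prod_image fun _ _ _ _ h => hu h, fLeft]

/-- The action of the transfer matrix on the Bethe vector multiplied by its denominators. -/
theorem transfer_action_betheNum (hT : RTT c T) (hc : c ≠ 0) {vac : V}
    (hvac : IsHighestWeight T lam vac) {u : Fin a → ℂ} {v : Fin b → ℂ}
    (hu : Function.Injective u) (hv : Function.Injective v) (huv : ∀ i j, u i ≠ v j) {w : ℂ}
    (hwu : ∀ i, w ≠ u i) (hwv : ∀ j, w ≠ v j) {X : Fin a → ℂ} {Y : Fin b → ℂ}
    (hX : ∀ j, X j = lam 0 (u j) * fLeft c u j -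
      lam 1 (u j) * (∏ k, f c (v k) (u j)) * fRight c u j)
    (hY : ∀ i, Y i = lam 2 (v i) * fRight c v i -
      lam 1 (v i) * fLeft c v i * ∏ k, f c (v i) (u k)) :
    transferMatrix T w
        (betheNum c T (lam 1) vac (Finset.univ.image u) (Finset.univ.image v)) =
      eigenvalue c lam u v w •
        betheNum c T (lam 1) vac (Finset.univ.image u) (Finset.univ.image v) +
      ∑ j, (g c w (u j) * X j) • betheNum c T (lam 1) vac
        (insert w ((Finset.univ.image u).erase (u j))) (Finset.univ.image v) +
      ∑ i, (g c (v i) w * Y i) • betheNum c T (lam 1) vac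
        (Finset.univ.image u) (insert w ((Finset.univ.image v).erase (v i))) +
      ∑ i, ∑ j, (g c (v i) (u j) *
        (g c w (v i) * rowWeight c (lam 1) ((Finset.univ.image u).erase (u j))
            (Finset.univ.image v) (v i) * X j +
          g c (u j) w * colWeight c (lam 1) (Finset.univ.image u)
            ((Finset.univ.image v).erase (v i)) (u j) * Y i)) •
        T 0 2 w (betheNum c T (lam 1) vac ((Finset.univ.image u).erase (u j))
          ((Finset.univ.image v).erase (v i))) := by
  have hdis : Disjoint (Finset.univ.image u) (Finset.univ.image v) := by
    rw [Finset.disjoint_left]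
    simp only [Finset.mem_image, Finset.mem_univ, true_and]
    rintro _ ⟨i, rfl⟩ ⟨j, h⟩
    exact huv i j h.symm
  have hwU : w ∉ Finset.univ.image u := by
    simp only [Finset.mem_image, Finset.mem_univ, true_and, not_exists]
    exact fun i h => hwu i h.symm
  have hwV : w ∉ Finset.univ.image v := by
    simp only [Finset.mem_image, Finset.mem_univ, true_and, not_exists]
    exact fun i h => hwv i h.symm
  have hempty : ∀ z s, z ∉ s → betheNum c T (lam 1) vac ∅ (insert z s) =
      T 1 2 z (betheNum c T (lam 1) vac ∅ s) := fun z s hz => by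
    rw [betheNum_empty_left, betheNum_empty_left, opSet_insert (hT.commute_same hc 1 2) hz]
  have hvac' : IsHighestWeight T lam (betheNum c T (lam 1) vac ∅ ∅) := by
    rwa [betheNum_empty_left, opSet_empty, Module.End.one_apply]
  have h := transfer_action hT hc hvac' (betheNum_isNested hT hc (lam 1) vac) hempty hdis hwU hwV
    (fun j => rfl) (fun i => rfl)
  rw [h, eigenvalue]
  simp only [Finset.sum_image fun _ _ _ _ h => hu h, Finset.sum_image fun _ _ _ _ h => hv h,
    Finset.prod_image fun _ _ _ _ h => hu h, Finset.prod_image fun _ _ _ _ h => hv h,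
    colWeight_image (lam 1) hu hv, rowWeight_image (lam 1) hu hv, prod_erase_image hu,
    prod_erase_image hv]
  simp only [hX, hY, fLeft, fRight]

/-- On-shell Bethe vectors are eigenvectors of the transfer matrix. -/
theorem transferMatrix_betheVector_of_betheEquations (hc : c ≠ 0) (hT : RTT c T) {vac : V}
    (hvac : IsHighestWeight T lam vac) {u : Fin a → ℂ} {v : Fin b → ℂ}
    (hu : Function.Injective u) (hv : Function.Injective v) (huv : ∀ i j, u i ≠ v j)
    (hsh : ∀ i j, v j - u i + c ≠ 0) (hlu : ∀ i, lam 1 (u i) ≠ 0) (hlv : ∀ j, lam 1 (v j) ≠ 0)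
    (hBE : BetheEquations c lam u v) {w : ℂ} (hwu : ∀ i, w ≠ u i) (hwv : ∀ j, w ≠ v j) :
    transferMatrix T w (betheVector c T lam vac u v) =
      eigenvalue c lam u v w • betheVector c T lam vac u v := by
  -- The Bethe equations, multiplied by `λ₂`, say exactly that the cleared coefficients vanish.
  have h := transfer_action_betheNum hT hc hvac hu hv huv hwu hwv (X := fun _ => 0)
    (Y := fun _ => 0)
    (fun j => by
      have h := hBE.1 j
      have h1 := hlu j
      rw [r, div_mul_eq_mul_div, div_eq_iff h1] at h
      linear_combination -h)
    (fun i => by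
      have h := hBE.2 i
      have h1 := hlv i
      rw [r, div_mul_eq_mul_div, div_eq_iff h1] at h
      linear_combination -h)
  rw [betheVector_eq_betheNum hT hc lam vac hu hv huv hsh hlv, map_smul, h]
  simp only [mul_zero, add_zero, zero_smul, Finset.sum_const_zero]
  rw [smul_comm]

/-- The action of the transfer matrix on a Bethe vector with generic parameters. -/
theorem transferMatrix_betheVector (hc : c ≠ 0) (hT : RTT c T) {vac : V}
    (hvac : IsHighestWeight T lam vac) {u : Fin a → ℂ} {v : Fin b → ℂ}
    (hu : Function.Injective u) (hv : Function.Injective v) (huv : ∀ i j, u i ≠ v j)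
    (hsh : ∀ i j, v j - u i + c ≠ 0) (hlu : ∀ i, lam 1 (u i) ≠ 0) (hlv : ∀ j, lam 1 (v j) ≠ 0)
    {w : ℂ} (hwu : ∀ i, w ≠ u i) (hwv : ∀ j, w ≠ v j) (hwsu : ∀ i, w - u i + c ≠ 0)
    (hwsv : ∀ j, v j - w + c ≠ 0) (hlw : lam 1 w ≠ 0) :
    transferMatrix T w (betheVector c T lam vac u v) =
      eigenvalue c lam u v w • betheVector c T lam vac u v
      + (lam 1 w * ∏ k, f c (v k) w) •
          ∑ j, (g c w (u j) * offShellU c lam u v j) •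
            betheVector c T lam vac (Function.update u j w) v
      + (lam 1 w * ∏ k, f c w (u k)) •
          ∑ i, (g c (v i) w * offShellV c lam u v i) •
            betheVector c T lam vac u (Function.update v i w)
      + lam 1 w • ∑ i, ∑ j,
          (g c (v i) (u j) *
            (g c w (v i) * fLeft c v i * offShellU c lam u v j
              + g c (u j) w * fRight c u j * offShellV c lam u v i)) •
            betheVector c T lam vac (Function.update u j w) (Function.update v i w) := by
  have hP : ∀ j, ∏ k, f c (v k) (u j) ≠ 0 := fun j => Finset.prod_ne_zero_iff.mpr fun k _ =>
    div_ne_zero (hsh j k) (sub_ne_zero.mpr (huv j k).symm)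
  have hQ : ∀ i, ∏ k, f c (v i) (u k) ≠ 0 := fun i => Finset.prod_ne_zero_iff.mpr fun k _ =>
    div_ne_zero (hsh k i) (sub_ne_zero.mpr (huv k i).symm)
  have hR : ∏ k, f c (v k) w ≠ 0 := Finset.prod_ne_zero_iff.mpr fun k _ =>
    div_ne_zero (hwsv k) (sub_ne_zero.mpr (hwv k).symm)
  have hS : ∏ k, f c w (u k) ≠ 0 := Finset.prod_ne_zero_iff.mpr fun k _ =>
    div_ne_zero (hwsu k) (sub_ne_zero.mpr (hwu k))
  have hLu : ∏ i, lam 1 (u i) ≠ 0 := Finset.prod_ne_zero_iff.mpr fun i _ => hlu i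
  have hLv : ∏ j, lam 1 (v j) ≠ 0 := Finset.prod_ne_zero_iff.mpr fun j _ => hlv j
  have hF : ∏ j, ∏ i, f c (v j) (u i) ≠ 0 := Finset.prod_ne_zero_iff.mpr fun j _ => hQ j
  set N : ℂ := (∏ i, lam 1 (u i)) * (∏ j, lam 1 (v j)) * ∏ j, ∏ i, f c (v j) (u i) with hN
  have hN0 : N ≠ 0 := mul_ne_zero (mul_ne_zero hLu hLv) hF
  -- The normalizations before and after the replacement differ only in the factors at `u_j` and at
  -- `w`; the prefactor `λ₂(w) f(v̄,w)` accounts for those at `w`.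
  have hU : ∀ j, (lam 1 w * ∏ k, f c (v k) w) • betheVector c T lam vac (Function.update u j w) v =
      (N⁻¹ * (lam 1 (u j) * ∏ k, f c (v k) (u j))) • betheNum c T (lam 1) vac
        (insert w ((Finset.univ.image u).erase (u j))) (Finset.univ.image v) := fun j => by
    have e1 := prod_update_mul u j w (lam 1)
    have e2 : (∏ q, ∏ i, f c (v q) (Function.update u j w i)) * ∏ q, f c (v q) (u j) =
        (∏ q, ∏ i, f c (v q) (u i)) * ∏ q, f c (v q) w := by
      simp only [← Finset.prod_mul_distrib]
      exact Finset.prod_congr rfl fun q _ => prod_update_mul u j w fun z => f c (v q) z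
    have h1 : ∏ i, lam 1 (Function.update u j w i) ≠ 0 := Finset.prod_ne_zero_iff.mpr fun i _ =>
      forall_update (p := fun z => lam 1 z ≠ 0) hlu hlw j i
    have h2 : ∏ q, ∏ i, f c (v q) (Function.update u j w i) ≠ 0 := fun h => by
      rw [h, zero_mul] at e2
      exact mul_ne_zero hF hR e2.symm
    have h3 := hlu j
    have h4 := hP j
    rw [betheVector_eq_betheNum hT hc lam vac (injective_update hu hwu j) hv
      (fun i q => forall_update (p := fun z => z ≠ v q) (fun i => huv i q) (hwv q) j i)
      (fun i q => forall_update (p := fun z => v q - z + c ≠ 0) (fun i => hsh i q) (hwsv q) j i)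
      hlv, image_update hu, smul_smul, hN]
    congr 1
    rw [← div_eq_mul_inv, inv_mul_eq_div, div_eq_div_iff (mul_ne_zero (mul_ne_zero h1 hLv) h2) hN0]
    linear_combination (-(∏ j, lam 1 (v j)) * (∏ q, ∏ i, f c (v q) (Function.update u j w i)) *
      ∏ q, f c (v q) (u j)) * e1 - (∏ j, lam 1 (v j)) * (∏ i, lam 1 (u i)) * lam 1 w * e2
  have hV : ∀ i, (lam 1 w * ∏ k, f c w (u k)) • betheVector c T lam vac u (Function.update v i w) =
      (N⁻¹ * (lam 1 (v i) * ∏ k, f c (v i) (u k))) • betheNum c T (lam 1) vac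
        (Finset.univ.image u) (insert w ((Finset.univ.image v).erase (v i))) := fun i => by
    have e1 := prod_update_mul v i w (lam 1)
    have e2 := prod_update_mul v i w fun z => ∏ k, f c z (u k)
    have h1 : ∏ q, lam 1 (Function.update v i w q) ≠ 0 := Finset.prod_ne_zero_iff.mpr fun q _ =>
      forall_update (p := fun z => lam 1 z ≠ 0) hlv hlw i q
    have h2 : ∏ q, ∏ k, f c (Function.update v i w q) (u k) ≠ 0 := fun h => by
      rw [h, zero_mul] at e2
      exact mul_ne_zero hF hS e2.symm
    rw [betheVector_eq_betheNum hT hc lam vac hu (injective_update hv hwv i)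
      (fun k q => forall_update (p := fun z => u k ≠ z) (fun q => huv k q) (hwu k).symm i q)
      (fun k q => forall_update (p := fun z => z - u k + c ≠ 0) (fun q => hsh k q) (hwsu k) i q)
      (fun q => forall_update (p := fun z => lam 1 z ≠ 0) hlv hlw i q),
      image_update hv, smul_smul, hN]
    congr 1
    rw [← div_eq_mul_inv, inv_mul_eq_div, div_eq_div_iff (mul_ne_zero (mul_ne_zero hLu h1) h2) hN0]
    linear_combination (-(∏ j, lam 1 (u j)) *
      (∏ q, ∏ k, f c (Function.update v i w q) (u k)) * ∏ k, f c (v i) (u k)) * e1 -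
      (∏ j, lam 1 (v j)) * (∏ i, lam 1 (u i)) * lam 1 w * e2
  -- Both sets now contain `w`, so the formula for disjoint sets is not available and
  -- `betheVector_of_common` replaces it.
  have hW : ∀ i j, ∀ p q : ℂ, (lam 1 w * (g c (v i) (u j) *
        (p * fLeft c v i * offShellU c lam u v j + q * fRight c u j * offShellV c lam u v i))) •
          betheVector c T lam vac (Function.update u j w) (Function.update v i w) =
      (N⁻¹ * (g c (v i) (u j) *
        (p * rowWeight c (lam 1) ((Finset.univ.image u).erase (u j)) (Finset.univ.image v) (v i) *
            (lam 1 (u j) * (∏ k, f c (v k) (u j)) * offShellU c lam u v j) +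
          q * colWeight c (lam 1) (Finset.univ.image u) ((Finset.univ.image v).erase (v i)) (u j) *
            (lam 1 (v i) * (∏ k, f c (v i) (u k)) * offShellV c lam u v i)))) •
        T 0 2 w (betheNum c T (lam 1) vac ((Finset.univ.image u).erase (u j))
          ((Finset.univ.image v).erase (v i))) := fun i j p q => by
    have hsh' : ∀ k l, Function.update v i w l - Function.update u j w k + c ≠ 0 := fun k l =>
      forall_update (p := fun z => z - Function.update u j w k + c ≠ 0)
        (fun l => forall_update (p := fun z => v l - z + c ≠ 0) (fun k => hsh k l) (hwsv l) j k)
        (forall_update (p := fun z => w - z + c ≠ 0) hwsu (by rwa [sub_self, zero_add]) j k) i l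
    have hwU : w ∉ (Finset.univ.image u).erase (u j) := by
      simp only [Finset.mem_erase, Finset.mem_image, Finset.mem_univ, true_and]
      rintro ⟨-, k, hk⟩
      exact hwu k hk.symm
    have hwV : w ∉ (Finset.univ.image v).erase (v i) := by
      simp only [Finset.mem_erase, Finset.mem_image, Finset.mem_univ, true_and]
      rintro ⟨-, k, hk⟩
      exact hwv k hk.symm
    have hdis : Disjoint ((Finset.univ.image u).erase (u j))
        ((Finset.univ.image v).erase (v i)) := by
      rw [Finset.disjoint_left]
      simp only [Finset.mem_erase, Finset.mem_image, Finset.mem_univ, true_and]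
      rintro _ ⟨-, k, rfl⟩ ⟨-, l, h⟩
      exact huv k l h.symm
    have hlv' : ∀ x ∈ (Finset.univ.image v).erase (v i), lam 1 x ≠ 0 := by
      simp only [Finset.mem_erase, Finset.mem_image, Finset.mem_univ, true_and]
      rintro _ ⟨-, k, rfl⟩
      exact hlv k
    rw [betheVector_of_common hT hc lam vac (injective_update hu hwu j) (injective_update hv hwv i)
      hsh' hwU hwV hdis (image_update hu w j) (image_update hv w i) hlv', smul_smul]
    congr 1
    simp only [rowWeight, colWeight, prod_erase_image hu, prod_erase_image hv]
    rw [← fLeft, ← fRight]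
    set A := ∏ k ∈ Finset.univ.erase j, f c (v i) (u k)
    set B := ∏ q ∈ Finset.univ.erase i, f c (v q) (u j)
    set N' := (∏ k ∈ Finset.univ.erase j, lam 1 (u k)) * (∏ q ∈ Finset.univ.erase i, lam 1 (v q)) *
      ∏ q ∈ Finset.univ.erase i, ∏ k ∈ Finset.univ.erase j, f c (v q) (u k) with hN'
    have hPB : ∏ k, f c (v k) (u j) = f c (v i) (u j) * B :=
      (Finset.mul_prod_erase Finset.univ (fun k => f c (v k) (u j)) (Finset.mem_univ i)).symm
    have hQA : ∏ k, f c (v i) (u k) = f c (v i) (u j) * A :=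
      (Finset.mul_prod_erase Finset.univ (fun k => f c (v i) (u k)) (Finset.mem_univ j)).symm
    have hNN : N = lam 1 (u j) * lam 1 (v i) * f c (v i) (u j) * A * B * N' := by
      rw [hN, ← Finset.mul_prod_erase Finset.univ (fun k => lam 1 (u k)) (Finset.mem_univ j),
        ← Finset.mul_prod_erase Finset.univ (fun q => lam 1 (v q)) (Finset.mem_univ i),
        ← Finset.mul_prod_erase Finset.univ (fun q => ∏ k, f c (v q) (u k)) (Finset.mem_univ i),
        hQA, ← Finset.prod_congr rfl fun q _ => Finset.mul_prod_erase Finset.univ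
          (fun k => f c (v q) (u k)) (Finset.mem_univ j), Finset.prod_mul_distrib, hN']
      ring
    have hN0' := hN0
    rw [hNN] at hN0'
    have hNz : N' ≠ 0 := right_ne_zero_of_mul hN0'
    rw [hPB, hQA, hNN, ← div_eq_mul_inv, inv_mul_eq_div, div_eq_div_iff (mul_ne_zero hlw hNz) hN0']
    ring
  rw [betheVector_eq_betheNum hT hc lam vac hu hv huv hsh hlv, map_smul,
    transfer_action_betheNum hT hc hvac hu hv huv hwu hwv
      (X := fun j => lam 1 (u j) * (∏ k, f c (v k) (u j)) * offShellU c lam u v j)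
      (Y := fun i => lam 1 (v i) * (∏ k, f c (v i) (u k)) * offShellV c lam u v i)
      (fun j => by
        have h1 := hlu j
        have h2 := hP j
        rw [offShellU, r]
        field_simp)
      (fun i => by
        have h1 := hlv i
        have h2 := hQ i
        rw [offShellV, r]
        field_simp), ← hN]
  simp only [smul_add, Finset.smul_sum]
  congr 1
  · congr 1
    · congr 1
      · rw [smul_comm]
      · refine Finset.sum_congr rfl fun j _ => ?_
        rw [smul_comm (lam 1 w * _), hU, smul_smul, smul_smul]
        congr 1
        ring
    · refine Finset.sum_congr rfl fun i _ => ?_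
      rw [smul_comm (lam 1 w * _), hV, smul_smul, smul_smul]
      congr 1
      ring
  · refine Finset.sum_congr rfl fun i _ => Finset.sum_congr rfl fun j _ => ?_
    rw [smul_smul, smul_smul, hW]

end Main

end GL3Bethe

theorem mainTheorem8 {V : Type*} [AddCommGroup V] [Module ℂ V]
    (c : ℂ) (hc : c ≠ 0)
    (T : Fin 3 → Fin 3 → ℂ → Module.End ℂ V) (hT : GL3Bethe.RTT c T)
    (lam : Fin 3 → ℂ → ℂ) (vac : V) (hvac : GL3Bethe.IsHighestWeight T lam vac)
    {a b : ℕ} (u : Fin a → ℂ) (v : Fin b → ℂ)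
    (hu : Function.Injective u) (hv : Function.Injective v)
    (huv : ∀ i j, u i ≠ v j) (hsh : ∀ i j, v j - u i + c ≠ 0)
    (hlu : ∀ i, lam 1 (u i) ≠ 0) (hlv : ∀ j, lam 1 (v j) ≠ 0) :
    -- the action of the transfer matrix on a Bethe vector with generic parameters;
    -- `Function.update u j w` is the set `{ū_j, w}`
    (∀ w : ℂ, (∀ i, w ≠ u i) → (∀ j, w ≠ v j) → (∀ i, w - u i + c ≠ 0) →
      (∀ j, v j - w + c ≠ 0) → lam 1 w ≠ 0 →
      GL3Bethe.transferMatrix T w (GL3Bethe.betheVector c T lam vac u v) =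
        GL3Bethe.eigenvalue c lam u v w • GL3Bethe.betheVector c T lam vac u v
        + (lam 1 w * ∏ k, GL3Bethe.f c (v k) w) •
            ∑ j, (GL3Bethe.g c w (u j) * GL3Bethe.offShellU c lam u v j) •
              GL3Bethe.betheVector c T lam vac (Function.update u j w) v
        + (lam 1 w * ∏ k, GL3Bethe.f c w (u k)) •
            ∑ i, (GL3Bethe.g c (v i) w * GL3Bethe.offShellV c lam u v i) •
              GL3Bethe.betheVector c T lam vac u (Function.update v i w)
        + lam 1 w • ∑ i, ∑ j,
            (GL3Bethe.g c (v i) (u j) *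
              (GL3Bethe.g c w (v i) * GL3Bethe.fLeft c v i * GL3Bethe.offShellU c lam u v j
                + GL3Bethe.g c (u j) w * GL3Bethe.fRight c u j * GL3Bethe.offShellV c lam u v i)) •
              GL3Bethe.betheVector c T lam vac (Function.update u j w) (Function.update v i w)) ∧
    -- on-shell Bethe vectors are eigenvectors of the transfer matrix
    (GL3Bethe.BetheEquations c lam u v →
      ∀ w : ℂ, (∀ i, w ≠ u i) → (∀ j, w ≠ v j) →
        GL3Bethe.transferMatrix T w (GL3Bethe.betheVector c T lam vac u v) =
          GL3Bethe.eigenvalue c lam u v w • GL3Bethe.betheVector c T lam vac u v) := by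
  refine ⟨fun w hwu hwv hwsu hwsv hlw => ?_, fun hBE w hwu hwv => ?_⟩
  · exact GL3Bethe.transferMatrix_betheVector hc hT hvac hu hv huv hsh hlu hlv hwu hwv hwsu hwsv
      hlw
  · exact GL3Bethe.transferMatrix_betheVector_of_betheEquations hc hT hvac hu hv huv hsh hlu hlv
      hBE hwu hwv
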